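/- Let $d\ge 2$ be an integer, let $\gamma\in\mathbb R$, and put $c=\gamma-d-1$. For $0<\beta<1$ let $\mathcal R_\beta$ be the operator acting on fields $\vartheta:\mathbb R^d\to\mathbb C^d$ by $$\mathcal R_\beta[\vartheta](\eta)=\beta^c e^{|\eta|^\gamma\left(1-\beta^{-\gamma}\right)}\,\vartheta\!\left(\frac{\eta}{\beta}\right)+i\gamma\int_1^{1/\beta}\frac{e^{|\eta|^\gamma(1-t^\gamma)}}{t^{c}}\int_{\mathbb R^d}\bigl(\eta\cdot\vartheta(\eta t-x)\bigr)\,P_\eta\vartheta(x)\,dx\,dt,$$ where $v\cdot\eta=\sum_j v_j\eta_j$ and $P_\eta v=v-\frac{v\cdot\eta}{|\eta|^2}\,\eta$. For $\nu\in\mathbb R$ let $u_\nu(x)=e^{|x|}|x|^\nu$, and for $p>1$ let $L^p_{u_\nu}$ be the space of measurable fields $f:\mathbb R^d\to\mathbb C^d$ (modulo equality almost everywhere) with $\int_{\mathbb R^d}|f(x)|^p u_\nu(x)^p\,dx<\infty$. Let $\mathfrak{RL}^p_{u_\nu}$ be the set of those $f\in L^p_{u_\nu}$ for which there is a field $\widehat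 f\in L^p_{u_\nu}$, depending on $|x|$ only, such that $|f|\le|\widehat f|$ almost everywhere. **Proposition.** Let $p>1$, $r>1$, $\nu$ and $\kappa$ be real numbers such that $$\frac1r=\frac2p+\frac{2\nu+\kappa}{d}-1,\qquad \kappa<\frac dr,\qquad \frac{d-1}{2}\left(1-\frac2p\right)<\nu<d\,\frac{p-1}{p},\tag{H1}$$ $$2r\ge p,\qquad \max\{\nu,\kappa\}>0,\qquad \nu+\kappa\ge(d-1)\left(\frac1r-\frac1p\right),$$ and $$\max\{0,\;d+p(c+\nu)\}<\frac{d(r-p)}{r}+p(\nu+\kappa+1)<\frac{\gamma p(r-1)}{r}.\tag{H2}$$ Then $\mathfrak{RL}^p_{u_\nu}$ is invariant under $\mathcal R_\beta$ for every $\beta\in(0,1)$: for every $\vartheta\in\mathfrak{RL}^p_{u_\nu}$, the double integral defining $\mathcal R_\beta[\vartheta](\eta)$ converges absolutely for almost every $\eta\in\mathbb R^d$, and $\mathcal R_\beta[\vartheta]\in\mathfrak{RL}^p_{u_\nu}$. -/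

import Mathlib

open MeasureTheory Set

noncomputable section

namespace NSRenorm

/-- The weight `u_ν(x) = e^{|x|} |x|^ν` on `ℝ^d`. -/
def uWeight {d : ℕ} (ν : ℝ) (x : EuclideanSpace ℝ (Fin d)) : ℝ :=
  Real.exp ‖x‖ * ‖x‖ ^ ν

/-- `f` is a measurable field with `∫ |f|^p w^p < ∞`. For fields with values in `ℂ^d ≅ ℝ^{2d}` this
says that each of the `2d` real components lies in the weighted space `L^p_w`. -/
def MemWeightedLp {d : ℕ} (w : EuclideanSpace ℝ (Fin d) → ℝ) (p : ℝ)
    (f : EuclideanSpace ℝ (Fin d) → EuclideanSpace ℂ (Fin d)) : Prop :=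
  AEStronglyMeasurable f volume ∧ MemLp (fun x => w x • f x) (ENNReal.ofReal p) volume

/-- A field that depends on the radial coordinate only. -/
def IsRadialField {d : ℕ} (f : EuclideanSpace ℝ (Fin d) → EuclideanSpace ℂ (Fin d)) : Prop :=
  ∀ x y, ‖x‖ = ‖y‖ → f x = f y

/-- The fields in the weighted `L^p_w` space that are dominated in norm (almost everywhere) by a
radial field of the same weighted space. -/
def radiallyDominated {d : ℕ} (w : EuclideanSpace ℝ (Fin d) → ℝ) (p : ℝ) :
    Set (EuclideanSpace ℝ (Fin d) → EuclideanSpace ℂ (Fin d)) :=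
  {f | MemWeightedLp w p f ∧
    ∃ g : EuclideanSpace ℝ (Fin d) → EuclideanSpace ℂ (Fin d),
      MemWeightedLp w p g ∧ IsRadialField g ∧ ∀ᵐ x ∂volume, ‖f x‖ ≤ ‖g x‖}

/-- The bilinear scalar product `η · v` of a real and a complex vector. -/
def dotC {d : ℕ} (η : EuclideanSpace ℝ (Fin d)) (v : EuclideanSpace ℂ (Fin d)) : ℂ :=
  ∑ i, (η i : ℂ) * v i

/-- The Leray projection `P_η v = v - ((v · η) / |η|²) η` (for `η ≠ 0`). -/
def leray {d : ℕ} (η : EuclideanSpace ℝ (Fin d)) (v : EuclideanSpace ℂ (Fin d)) :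
    EuclideanSpace ℂ (Fin d) :=
  WithLp.toLp 2 fun i => v i - dotC η v / (‖η‖ : ℂ) ^ 2 * (η i : ℂ)

/-- The exponent `c = γ - d - 1`. -/
def cExp (d : ℕ) (γ : ℝ) : ℝ := γ - d - 1

/-- The bilinear integrand `(η · ϑ(tη - x)) P_η ϑ(x)` of the nonlinear term. -/
def bilinearIntegrand {d : ℕ} (ϑ : EuclideanSpace ℝ (Fin d) → EuclideanSpace ℂ (Fin d))
    (η : EuclideanSpace ℝ (Fin d)) (t : ℝ) (x : EuclideanSpace ℝ (Fin d)) :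
    EuclideanSpace ℂ (Fin d) :=
  dotC η (ϑ (t • η - x)) • leray η (ϑ x)

/-- The factor `e^{|η|^γ (1 - t^γ)} / t^c`. -/
def timeFactor {d : ℕ} (γ : ℝ) (η : EuclideanSpace ℝ (Fin d)) (t : ℝ) : ℝ :=
  Real.exp (‖η‖ ^ γ * (1 - t ^ γ)) / t ^ cExp d γ

/-- The renormalization operator
`R_β[ϑ](η) = β^c e^{|η|^γ (1 - 1/β^γ)} ϑ(η/β)
  + i γ ∫_1^{1/β} e^{|η|^γ (1 - t^γ)} / t^c ∫_{ℝ^d} (η · ϑ(ηt - x)) P_η ϑ(x) dx dt`. -/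
def renorm {d : ℕ} (γ β : ℝ) (ϑ : EuclideanSpace ℝ (Fin d) → EuclideanSpace ℂ (Fin d))
    (η : EuclideanSpace ℝ (Fin d)) : EuclideanSpace ℂ (Fin d) :=
  (β ^ cExp d γ * Real.exp (‖η‖ ^ γ * (1 - 1 / β ^ γ))) • ϑ ((1 / β) • η) +
    (Complex.I * (γ : ℂ)) •
      ∫ t in (1 : ℝ)..(1 / β), timeFactor γ η t • ∫ x, bilinearIntegrand ϑ η t x

/-- All integrals in `R_β[ϑ](η)` converge absolutely: the integrand of the nonlinear term is
integrable in `(t, x)` over `(1, 1/β] × ℝ^d`. -/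
def RenormConvergesAt {d : ℕ} (γ β : ℝ)
    (ϑ : EuclideanSpace ℝ (Fin d) → EuclideanSpace ℂ (Fin d))
    (η : EuclideanSpace ℝ (Fin d)) : Prop :=
  Integrable
    (fun q : ℝ × EuclideanSpace ℝ (Fin d) => timeFactor γ η q.1 • bilinearIntegrand ϑ η q.1 q.2)
    ((volume.restrict (Ioc 1 (1 / β))).prod volume)

/-- The operator is well defined on classes of fields modulo equality almost everywhere. -/
theorem renorm_congr_ae {d : ℕ} {γ β : ℝ} (hβ : 0 < β)
    {ϑ ϑ' : EuclideanSpace ℝ (Fin d) → EuclideanSpace ℂ (Fin d)} (h : ϑ =ᵐ[volume] ϑ') :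
    renorm γ β ϑ =ᵐ[volume] renorm γ β ϑ' := by
  have h1 : ∀ᵐ η : EuclideanSpace ℝ (Fin d) ∂volume, ϑ ((1 / β) • η) = ϑ' ((1 / β) • η) :=
    (Measure.quasiMeasurePreserving_smul volume (by positivity : (1 / β : ℝ) ≠ 0)).ae h
  filter_upwards [h1] with η hη
  have h2 : ∀ t : ℝ, ∫ x, bilinearIntegrand ϑ η t x = ∫ x, bilinearIntegrand ϑ' η t x := by
    intro t
    apply integral_congr_ae
    have h3 : ∀ᵐ x : EuclideanSpace ℝ (Fin d) ∂volume, ϑ (t • η - x) = ϑ' (t • η - x) :=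
      (quasiMeasurePreserving_sub_left volume (t • η)).ae h
    filter_upwards [h, h3] with x hx hx'
    simp only [bilinearIntegrand, hx, hx']
  simp only [renorm, hη, h2]

end NSRenorm

end

open scoped ENNReal

/-! ### Young's inequality for kernels, and truncated powers on the line. -/

namespace NSRenorm

/-! Write d = n + 1 and dominate |ϑ| by a radial field with |g(x)| = e^{-|x|} F(|x|). For t ≥ 1 the
triangle inequality gives e^{-|x|} e^{-|tη-x|} ≤ e^{-|η|}, so the exponential weight passes through
the convolution. With ρ = |η|, the nonlinear term is at most a constant times ρ e^{-ρ} ∫_1^{1/β}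
e^{ρ^γ(1-t^γ)} (F*F)(ρt) dt, where F*F is `radConv`. It therefore suffices to bound this radial
expression for each ρ.

Hölder in t separates two factors. The exponential contributes min(1, ρ^{-γ})^{1-1/r}
(`exists_lintegral_exp_le`). The L^r norm of t ↦ (F*F)(ρt) on [1, 1/β] is, by scaling, a multiple of
ρ^{κ-d/r} (`exists_lintegral_radConv_mul_rpow_le`). The result is an explicit radial function, and
it lies in the weighted space when its powers are integrable at 0 and at infinity, which is what
(H2) provides (`memLp_radial_power`, `memWeightedLp_dominatingField`). The linear term is controlled
because u_ν(η) ≤ β^ν u_ν(η/β).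

The analytic core is the bound for F*F on the shell 1 ≤ s ≤ L (`exists_lintegral_radConv_rpow_le`).
Radiality reduces it to one-dimensional estimates: in bipolar coordinates a = |x|, b = |y-x| with s
= |y|, the convolution becomes a bilinear form whose kernel lives on triangles with sides a, b, s
(`radConv_le_bipolar`, `bipolarKernel_le`). Take a ≤ b. If a < 1, then b is comparable to 1 and the
form is a weighted fractional integral followed by a convolution. If a ≥ 1, then b is comparable to
a, and a decaying power of a multiplies a truncated power of the distance from s to b - a or b + a.
Both cases follow from Young and Hölder. Degenerate triangles produce an inverse square root
singularity only when d = 2.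

These estimates need r ≥ p and a strict form of the condition on ν + κ. Neither need hold for the
given r, but the power of ρ above does not depend on r, and `exists_admissible_exponent` supplies a
suitable replacement. -/

theorem lintegral_rpow_mul_rpow_mul_rpow_le {α : Type*} [MeasurableSpace α] {μ : Measure α}
    {f g h : α → ℝ≥0∞} (hf : Measurable f) (hg : Measurable g) (hh : Measurable h)
    {a b c : ℝ} (ha : 0 ≤ a) (hb : 0 ≤ b) (hc : 0 ≤ c) (habc : a + b + c = 1) :
    ∫⁻ x, f x ^ a * g x ^ b * h x ^ c ∂μ ≤
      (∫⁻ x, f x ∂μ) ^ a * (∫⁻ x, g x ∂μ) ^ b * (∫⁻ x, h x ∂μ) ^ c := by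
  have := ENNReal.lintegral_prod_norm_pow_le (μ := μ) (Finset.univ : Finset (Fin 3))
    (f := ![f, g, h]) (p := ![a, b, c])
    (by intro i _; fin_cases i <;> simp <;> [exact hf.aemeasurable; exact hg.aemeasurable;
      exact hh.aemeasurable])
    (by simp [Fin.sum_univ_three, habc]) (by intro i _; fin_cases i <;> simp [ha, hb, hc])
  simpa [Fin.prod_univ_three] using this

/-- Jensen's inequality for powers. -/
theorem lintegral_rpow_le_of_le {α : Type*} [MeasurableSpace α] {μ : Measure α}
    {f : α → ℝ≥0∞} (hf : Measurable f) {q p : ℝ} (hq : 0 < q) (hqp : q ≤ p) :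
    ∫⁻ x, f x ^ q ∂μ ≤ (∫⁻ x, f x ^ p ∂μ) ^ (q / p) * μ univ ^ (1 - q / p) := by
  have hp : 0 < p := hq.trans_le hqp
  have := ENNReal.lintegral_mul_norm_pow_le (μ := μ) (f := fun x => f x ^ p) (g := fun _ => 1)
    (hf.pow_const p).aemeasurable aemeasurable_const (p := q / p) (q := 1 - q / p) (by positivity)
    (by rw [sub_nonneg, div_le_one hp]; exact hqp) (by ring)
  simpa [← ENNReal.rpow_mul, mul_div_cancel₀ _ hp.ne'] using this

/-- Young's inequality for integral operators with a kernel whose `m`-th powers have bounded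
marginals. -/
theorem lintegral_lintegral_mul_rpow_le {α β : Type*} [MeasurableSpace α] [MeasurableSpace β]
    {μ : Measure α} {ν : Measure β} [SFinite μ] [SFinite ν]
    {k : β → α → ℝ≥0∞} {f : α → ℝ≥0∞} (hk : Measurable (Function.uncurry k)) (hf : Measurable f)
    {p q m : ℝ} (hp : 1 ≤ p) (hpq : p ≤ q) (hm : 0 < m) (hmpq : 1 / q + (1 - 1 / p) = 1 / m)
    {A B : ℝ≥0∞} (hA : ∀ a, ∫⁻ u, k u a ^ m ∂ν ≤ A) (hB : ∀ u, ∫⁻ a, k u a ^ m ∂μ ≤ B) :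
    ∫⁻ u, (∫⁻ a, k u a * f a ∂μ) ^ q ∂ν ≤
      A * B ^ (q * (1 - 1 / p)) * (∫⁻ a, f a ^ p ∂μ) ^ (q / p) := by
  have hp0 : 0 < p := by linarith
  have hq0 : 0 < q := by linarith
  have hku : ∀ u, Measurable (k u) := fun u => hk.comp measurable_prodMk_left
  have h1p : 1 / p ≤ 1 := by rw [div_le_one hp0]; exact hp
  have h1q : 1 / q ≤ 1 / p := one_div_le_one_div_of_le hp0 hpq
  -- Three-factor Hölder with exponents 1/q, 1/p - 1/q and 1 - 1/p, applied to k^m f^p, f^p and k^m.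
  -- The relation between p, q and m makes the powers of k add up to one.
  have key : ∀ u, (∫⁻ a, k u a * f a ∂μ) ^ q ≤
      (∫⁻ a, k u a ^ m * f a ^ p ∂μ) * (∫⁻ a, f a ^ p ∂μ) ^ (q / p - 1) *
        B ^ (q * (1 - 1 / p)) := by
    intro u
    have h := lintegral_rpow_mul_rpow_mul_rpow_le (μ := μ) (f := fun a => k u a ^ m * f a ^ p)
      (g := fun a => f a ^ p) (h := fun a => k u a ^ m)
      (((hku u).pow_const m).mul (hf.pow_const p)) (hf.pow_const p) ((hku u).pow_const m)
      (a := 1 / q) (b := 1 / p - 1 / q) (c := 1 - 1 / p) (by positivity) (by linarith)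
      (by linarith) (by ring)
    have e : ∀ a, (k u a ^ m * f a ^ p) ^ (1 / q) * (f a ^ p) ^ (1 / p - 1 / q) *
        (k u a ^ m) ^ (1 - 1 / p) = k u a * f a := by
      intro a
      rw [ENNReal.mul_rpow_of_nonneg _ _ (by positivity : 0 ≤ 1 / q), ← ENNReal.rpow_mul,
        ← ENNReal.rpow_mul, ← ENNReal.rpow_mul, ← ENNReal.rpow_mul,
        show ∀ x y z w : ℝ≥0∞, x * y * z * w = (x * w) * (y * z) by intros; ring,
        ← ENNReal.rpow_add_of_nonneg _ _ (by positivity) (mul_nonneg hm.le (by linarith)),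
        ← ENNReal.rpow_add_of_nonneg _ _ (by positivity) (mul_nonneg hp0.le (by linarith)),
        ← mul_add, ← mul_add, hmpq, mul_one_div_cancel hm.ne',
        show p * (1 / q + (1 / p - 1 / q)) = 1 by field_simp; ring]
      simp
    simp only [e] at h
    calc (∫⁻ a, k u a * f a ∂μ) ^ q
        ≤ ((∫⁻ a, k u a ^ m * f a ^ p ∂μ) ^ (1 / q) * (∫⁻ a, f a ^ p ∂μ) ^ (1 / p - 1 / q) *
            B ^ (1 - 1 / p)) ^ q := by
          gcongr
          refine h.trans ?_
          gcongr
          exact hB u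
      _ = _ := by
          rw [ENNReal.mul_rpow_of_nonneg _ _ hq0.le, ENNReal.mul_rpow_of_nonneg _ _ hq0.le,
            ← ENNReal.rpow_mul, ← ENNReal.rpow_mul, ← ENNReal.rpow_mul]
          rw [one_div_mul_cancel hq0.ne', ENNReal.rpow_one, mul_comm (1 - 1 / p) q,
            show (1 / p - 1 / q) * q = q / p - 1 by field_simp]
  have hswap : ∫⁻ u, ∫⁻ a, k u a ^ m * f a ^ p ∂μ ∂ν ≤ A * ∫⁻ a, f a ^ p ∂μ := by
    rw [lintegral_lintegral_swap
      ((hk.pow_const m).mul ((hf.pow_const p).comp measurable_snd)).aemeasurable,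
      ← lintegral_const_mul _ (hf.pow_const p)]
    refine lintegral_mono fun a => ?_
    have hka : Measurable fun u => k u a := hk.comp measurable_prodMk_right
    rw [lintegral_mul_const _ (hka.pow_const m)]
    gcongr
    exact hA a
  have hmeas : Measurable fun u => ∫⁻ a, k u a ^ m * f a ^ p ∂μ :=
    ((hk.pow_const m).mul ((hf.pow_const p).comp measurable_snd)).lintegral_prod_right'
  calc ∫⁻ u, (∫⁻ a, k u a * f a ∂μ) ^ q ∂ν
      ≤ ∫⁻ u, (∫⁻ a, k u a ^ m * f a ^ p ∂μ) * (∫⁻ a, f a ^ p ∂μ) ^ (q / p - 1) *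
        B ^ (q * (1 - 1 / p)) ∂ν := lintegral_mono key
    _ = (∫⁻ u, ∫⁻ a, k u a ^ m * f a ^ p ∂μ ∂ν) * (∫⁻ a, f a ^ p ∂μ) ^ (q / p - 1) *
        B ^ (q * (1 - 1 / p)) := by
          rw [lintegral_mul_const _ (hmeas.mul_const _), lintegral_mul_const _ hmeas]
    _ ≤ (A * ∫⁻ a, f a ^ p ∂μ) * (∫⁻ a, f a ^ p ∂μ) ^ (q / p - 1) * B ^ (q * (1 - 1 / p)) := by
          gcongr
    _ = A * B ^ (q * (1 - 1 / p)) * ((∫⁻ a, f a ^ p ∂μ) ^ (1 : ℝ) *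
          (∫⁻ a, f a ^ p ∂μ) ^ (q / p - 1)) := by rw [ENNReal.rpow_one]; ring
    _ = _ := by
          rw [← ENNReal.rpow_add_of_nonneg _ _ zero_le_one
            (by rw [sub_nonneg, one_le_div hp0]; exact hpq)]
          congr 2; ring

/-- The function `v ↦ v ^ q` on `(0, T)`, extended by zero. -/
noncomputable def truncPow (q T : ℝ) : ℝ → ℝ≥0∞ := (Ioo 0 T).indicator fun v => ENNReal.ofReal (v ^ q)

theorem measurable_truncPow (q T : ℝ) : Measurable (truncPow q T) :=
  Measurable.indicator (by fun_prop) measurableSet_Ioo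

theorem lintegral_truncPow {q : ℝ} (hq : -1 < q) {T : ℝ} (hT : 0 ≤ T) :
    ∫⁻ v, truncPow q T v = ENNReal.ofReal (T ^ (q + 1) / (q + 1)) := by
  have hi : IntegrableOn (fun v : ℝ => v ^ q) (Ioo 0 T) := by
    have := (intervalIntegral.intervalIntegrable_rpow' (a := 0) (b := T) hq).1
    exact this.mono_set Ioo_subset_Ioc_self
  rw [truncPow, lintegral_indicator measurableSet_Ioo, ← ofReal_integral_eq_lintegral_ofReal hi,
    ← integral_Ioc_eq_integral_Ioo, ← intervalIntegral.integral_of_le hT,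
    integral_rpow (Or.inl hq), Real.zero_rpow (by linarith), sub_zero]
  filter_upwards [ae_restrict_mem measurableSet_Ioo] with v hv
  exact Real.rpow_nonneg hv.1.le _

theorem lintegral_truncPow_sub {q : ℝ} (hq : -1 < q) {T : ℝ} (hT : 0 ≤ T) (c : ℝ) :
    ∫⁻ v, truncPow q T (v - c) = ENNReal.ofReal (T ^ (q + 1) / (q + 1)) := by
  rw [lintegral_sub_right_eq_self (truncPow q T) c, lintegral_truncPow hq hT]

theorem lintegral_truncPow_sub' {q : ℝ} (hq : -1 < q) {T : ℝ} (hT : 0 ≤ T) (c : ℝ) :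
    ∫⁻ v, truncPow q T (c - v) = ENNReal.ofReal (T ^ (q + 1) / (q + 1)) := by
  rw [lintegral_sub_left_eq_self (truncPow q T) c, lintegral_truncPow hq hT]

theorem lintegral_comp_abs_sub_le {g : ℝ → ℝ≥0∞} (hg : Measurable g) (c : ℝ) :
    ∫⁻ v, g |v - c| ≤ 2 * ∫⁻ v, g v := by
  have hm : Measurable fun v => g (v - c) := hg.comp (measurable_id.sub_const c)
  calc ∫⁻ v, g |v - c| ≤ ∫⁻ v, (g (v - c) + g (c - v)) := by
        refine lintegral_mono fun v => ?_
        rcases abs_choice (v - c) with h | h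
        · rw [h]; exact le_self_add
        · rw [h, neg_sub]; exact le_add_self
    _ = _ := by
        rw [lintegral_add_left hm, lintegral_sub_right_eq_self, lintegral_sub_left_eq_self,
          two_mul]

theorem lintegral_truncPow_abs_sub_le {q : ℝ} (hq : -1 < q) {T : ℝ} (hT : 0 ≤ T) (c : ℝ) :
    ∫⁻ v, truncPow q T |v - c| ≤ 2 * ENNReal.ofReal (T ^ (q + 1) / (q + 1)) := by
  rw [← lintegral_truncPow hq hT]
  exact lintegral_comp_abs_sub_le (measurable_truncPow q T) c

end NSRenorm

/-! ### Weighted fractional integrals: triangles with a short side. -/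

namespace NSRenorm

theorem truncPow_rpow {q T m : ℝ} (hm : 0 < m) (v : ℝ) :
    truncPow q T v ^ m = truncPow (q * m) T v := by
  by_cases hv : v ∈ Ioo 0 T
  · simp only [truncPow, indicator_of_mem hv]
    rw [ENNReal.ofReal_rpow_of_nonneg (Real.rpow_nonneg hv.1.le _) hm.le, ← Real.rpow_mul hv.1.le]
  · simp only [truncPow, indicator_of_notMem hv, ENNReal.zero_rpow_of_pos hm]

/-- The kernel `a ^ (e + l) (a - u) ^ (-l)` on `0 ≤ u < a < 1` of a weighted fractional integral. -/
noncomputable def weylKernel (l e u a : ℝ) : ℝ≥0∞ :=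
  if 0 ≤ u ∧ u < a ∧ a < 1 then ENNReal.ofReal (a ^ (e + l) * (a - u) ^ (-l)) else 0

theorem measurable_weylKernel (l e : ℝ) : Measurable (Function.uncurry (weylKernel l e)) := by
  unfold weylKernel Function.uncurry
  refine Measurable.ite ?_ (by fun_prop) measurable_const
  exact (measurableSet_le measurable_const measurable_fst).inter
    ((measurableSet_lt measurable_fst measurable_snd).inter
      (measurableSet_lt measurable_snd measurable_const))

/-- The family is closed under powers, so the marginals of m-th powers required by Young's
inequality are marginals of kernels of the same type. -/
theorem weylKernel_rpow {l e m : ℝ} (hm : 0 < m) (u a : ℝ) :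
    weylKernel l e u a ^ m = weylKernel (l * m) (e * m) u a := by
  unfold weylKernel
  split_ifs with h
  · have ha : 0 ≤ a := h.1.trans h.2.1.le
    have hau : 0 ≤ a - u := by linarith [h.2.1]
    rw [ENNReal.ofReal_rpow_of_nonneg (by positivity) hm.le, Real.mul_rpow (by positivity)
      (by positivity), ← Real.rpow_mul ha, ← Real.rpow_mul hau]
    ring_nf
  · exact ENNReal.zero_rpow_of_pos hm

/-- Integrating (a - u)^{-l} over 0 < u < a gives a^{1-l}/(1-l), and the remaining factor a^{e+1} is
at most 1. -/
theorem lintegral_weylKernel_left_le {l e : ℝ} (hl : l < 1) (he : -1 < e) (a : ℝ) :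
    ∫⁻ u, weylKernel l e u a ≤ ENNReal.ofReal (1 / (1 - l)) := by
  by_cases ha : 0 < a ∧ a < 1
  · calc ∫⁻ u, weylKernel l e u a
        ≤ ∫⁻ u, ENNReal.ofReal (a ^ (e + l)) * truncPow (-l) a (a - u) := by
          refine lintegral_mono_ae ?_
          -- The kernel admits u = 0, where a - u = a falls outside the open interval supporting
          -- `truncPow`.
          filter_upwards [Measure.ae_ne volume (0 : ℝ)] with u hu
          unfold weylKernel
          split_ifs with h
          · have ha' := ha.1
            have : a - u ∈ Ioo 0 a :=
              ⟨by linarith [h.2.1], by linarith [lt_of_le_of_ne h.1 hu.symm]⟩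
            rw [truncPow, indicator_of_mem this, ← ENNReal.ofReal_mul (by positivity)]
          · exact zero_le
      _ = ENNReal.ofReal (a ^ (e + 1) / (1 - l)) := by
          rw [lintegral_const_mul' _ _ ENNReal.ofReal_ne_top,
            lintegral_truncPow_sub' (by linarith) ha.1.le, ← ENNReal.ofReal_mul
            (Real.rpow_nonneg ha.1.le _), ← mul_div_assoc, ← Real.rpow_add ha.1]
          ring_nf
      _ ≤ _ := by
          apply ENNReal.ofReal_le_ofReal
          gcongr
          exact Real.rpow_le_one ha.1.le ha.2.le (by linarith)
  · have : ∀ u, weylKernel l e u a = 0 := fun u => by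
      unfold weylKernel
      rw [if_neg fun h => ha ⟨h.1.trans_lt h.2.1, h.2.2⟩]
    simp [this]

/-- If e + l ≥ 0, then a^{e+l} ≤ 1 and (a - u)^{-l} remains. Otherwise a ≥ a - u turns the kernel
into at most (a - u)^e. Both are integrable uniformly in u. -/
theorem lintegral_weylKernel_right_le {l e : ℝ} (hl : l < 1) (he : -1 < e) (u : ℝ) :
    ∫⁻ a, weylKernel l e u a ≤ ENNReal.ofReal (1 / (1 - l)) + ENNReal.ofReal (1 / (1 + e)) := by
  have hm : Measurable fun a => truncPow (-l) 1 (a - u) :=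
    (measurable_truncPow _ _).comp (measurable_id.sub_const u)
  calc ∫⁻ a, weylKernel l e u a
      ≤ ∫⁻ a, (truncPow (-l) 1 (a - u) + truncPow e 1 (a - u)) := by
        refine lintegral_mono fun a => ?_
        unfold weylKernel
        split_ifs with h
        · have ha : 0 < a := h.1.trans_lt h.2.1
          have hau : 0 < a - u := by linarith [h.2.1]
          have : a - u ∈ Ioo 0 1 := ⟨hau, by linarith⟩
          simp only [truncPow, indicator_of_mem this]
          rw [← ENNReal.ofReal_add (by positivity) (by positivity)]
          apply ENNReal.ofReal_le_ofReal
          rcases le_total 0 (e + l) with h0 | h0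
          · have : a ^ (e + l) ≤ 1 := Real.rpow_le_one ha.le h.2.2.le h0
            have h2 : 0 ≤ (a - u) ^ (-l) := by positivity
            have h3 : 0 ≤ (a - u) ^ e := by positivity
            nlinarith
          · have : a ^ (e + l) ≤ (a - u) ^ (e + l) :=
              Real.rpow_le_rpow_of_nonpos hau (by linarith) h0
            calc a ^ (e + l) * (a - u) ^ (-l) ≤ (a - u) ^ (e + l) * (a - u) ^ (-l) := by gcongr
              _ = (a - u) ^ e := by rw [← Real.rpow_add hau]; ring_nf
              _ ≤ _ := le_add_of_nonneg_left (by positivity)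
        · exact zero_le
    _ = _ := by
        rw [lintegral_add_left hm, lintegral_truncPow_sub (by linarith) zero_le_one,
          lintegral_truncPow_sub he zero_le_one, Real.one_rpow, Real.one_rpow]
        ring_nf

theorem weylKernel_mul_rpow {l e δ u a : ℝ} :
    weylKernel l e u a =
      weylKernel l (e - δ) u a * (Ioo (0 : ℝ) 1).indicator (fun a => ENNReal.ofReal (a ^ δ)) a := by
  unfold weylKernel
  split_ifs with h
  · have ha : 0 < a := h.1.trans_lt h.2.1
    have hau : 0 < a - u := by linarith [h.2.1]
    rw [indicator_of_mem (show a ∈ Ioo (0 : ℝ) 1 from ⟨ha, h.2.2⟩), ← ENNReal.ofReal_mul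
      (by positivity), mul_right_comm, ← Real.rpow_add ha]
    ring_nf
  · simp

/-- Weighted Hölder inequality on `(0, 1)`. -/
theorem lintegral_indicator_rpow_mul_rpow_le {p q δ : ℝ} (hq : 0 < q) (hqp : q < p)
    (hδ : 1 / p - 1 / q < δ) :
    ∃ C : ℝ≥0∞, C ≠ ⊤ ∧ ∀ w : ℝ → ℝ≥0∞, Measurable w →
      ∫⁻ a, ((Ioo (0 : ℝ) 1).indicator (fun a => ENNReal.ofReal (a ^ δ)) a * w a) ^ q ≤
        C * (∫⁻ a, w a ^ p) ^ (q / p) := by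
  have hp : 0 < p := hq.trans hqp
  have hθ : 0 < 1 - q / p := by rw [sub_pos, div_lt_one hp]; exact hqp
  -- The exponent of a left by Hölder with weights 1 - q/p and q/p. It equals -1 exactly when δ =
  -- 1/p - 1/q, so the hypothesis on δ is integrability at 0.
  set x : ℝ := δ * (q / (1 - q / p)) with hx
  have hx1 : -1 < x := by
    have : (1 / p - 1 / q) * (q / (1 - q / p)) < x :=
      mul_lt_mul_of_pos_right hδ (by positivity)
    have h2 : (1 / p - 1 / q) * (q / (1 - q / p)) = -1 := by
      have : p - q ≠ 0 := by linarith
      field_simp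
      ring
    linarith
  refine ⟨ENNReal.ofReal (1 / (x + 1)) ^ (1 - q / p),
    ENNReal.rpow_ne_top_of_nonneg hθ.le ENNReal.ofReal_ne_top, fun w hw => ?_⟩
  have h := ENNReal.lintegral_mul_norm_pow_le (μ := volume) (f := truncPow x 1)
    (g := fun a => w a ^ p) (measurable_truncPow _ _).aemeasurable (hw.pow_const p).aemeasurable
    (p := 1 - q / p) (q := q / p) hθ.le (by positivity) (by ring)
  rw [lintegral_truncPow hx1 zero_le_one, Real.one_rpow] at h
  refine le_trans (le_of_eq (lintegral_congr fun a => ?_)) h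
  rw [truncPow_rpow hθ, ENNReal.mul_rpow_of_nonneg _ _ hq.le, ← ENNReal.rpow_mul,
    mul_div_cancel₀ _ hp.ne']
  congr 1
  have := truncPow_rpow (q := δ) (T := 1) hq a
  rw [truncPow] at this
  rw [this, hx]
  rw [mul_assoc, div_mul_cancel₀ _ hθ.ne']

/-- For p ≤ q this is Young's inequality, the conditions on l and e being integrability of the m-th
power marginals. For q < p a factor a^δ is split off the kernel: it brings w from L^p down to L^q,
and the rest of the kernel is bounded on L^q by the case m = 1. -/
theorem exists_lintegral_weylKernel_mul_rpow_le {p q l e : ℝ} (hp : 1 < p) (hq : 1 ≤ q)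
    (hl1 : l < 1) (hl : l < 1 / q + (1 - 1 / p)) (he : 0 < e + (1 / q + (1 - 1 / p))) :
    ∃ C : ℝ≥0∞, C ≠ ⊤ ∧ ∀ w : ℝ → ℝ≥0∞, Measurable w →
      ∫⁻ u, (∫⁻ a, weylKernel l e u a * w a) ^ q ≤ C * (∫⁻ a, w a ^ p) ^ (q / p) := by
  have hq0 : 0 < q := by linarith
  have hp0 : 0 < p := by linarith
  have h1p : 1 / p < 1 := by rw [div_lt_one hp0]; exact hp
  rcases le_or_gt p q with hpq | hpq
  · set t : ℝ := 1 / q + (1 - 1 / p) with ht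
    have ht0 : 0 < t := by have : 0 < 1 / q := by positivity
                           linarith
    have hlt : l * (1 / t) < 1 := by rw [mul_one_div, div_lt_one ht0]; exact hl
    have het : -1 < e * (1 / t) := by rw [mul_one_div, lt_div_iff₀ ht0]; linarith
    refine ⟨_, ?_, fun w hw => lintegral_lintegral_mul_rpow_le (μ := volume) (ν := volume)
      (measurable_weylKernel l e) hw hp.le hpq (m := 1 / t) (by positivity) (by rw [one_div_one_div])
      (A := ENNReal.ofReal (1 / (1 - l * (1 / t))))
      (B := ENNReal.ofReal (1 / (1 - l * (1 / t))) + ENNReal.ofReal (1 / (1 + e * (1 / t))))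
      (fun a => ?_) (fun u => ?_)⟩
    · exact ENNReal.mul_ne_top ENNReal.ofReal_ne_top
        (ENNReal.rpow_ne_top_of_nonneg (mul_nonneg hq0.le (by linarith)) (by simp))
    · simp only [weylKernel_rpow (show 0 < 1 / t by positivity)]
      exact lintegral_weylKernel_left_le hlt het a
    · simp only [weylKernel_rpow (show 0 < 1 / t by positivity)]
      exact lintegral_weylKernel_right_le hlt het u
  -- The lower bound lets a^δ map L^p to L^q; the upper bound keeps the residual exponent e - δ
  -- above -1.
  · obtain ⟨δ, hδ1, hδ2⟩ := exists_between (show 1 / p - 1 / q < e + 1 by linarith)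
    obtain ⟨C, hC, hCw⟩ := lintegral_indicator_rpow_mul_rpow_le hq0 hpq hδ1
    set B := ENNReal.ofReal (1 / (1 - l)) + ENNReal.ofReal (1 / (1 + (e - δ))) with hB
    refine ⟨ENNReal.ofReal (1 / (1 - l)) * B ^ (q * (1 - 1 / q)) * C, ?_, fun w hw => ?_⟩
    · have : 0 ≤ 1 - 1 / q := by rw [sub_nonneg, div_le_one hq0]; exact hq
      exact ENNReal.mul_ne_top (ENNReal.mul_ne_top ENNReal.ofReal_ne_top
        (ENNReal.rpow_ne_top_of_nonneg (by positivity) (by simp [hB]))) hC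
    · have hmw : Measurable fun a =>
          (Ioo (0 : ℝ) 1).indicator (fun a => ENNReal.ofReal (a ^ δ)) a * w a :=
        (Measurable.indicator (by fun_prop) measurableSet_Ioo).mul hw
      have h := lintegral_lintegral_mul_rpow_le (μ := volume) (ν := volume)
        (measurable_weylKernel l (e - δ)) hmw hq le_rfl (m := 1) one_pos (by ring)
        (A := ENNReal.ofReal (1 / (1 - l))) (B := B)
        (fun a => by
          simp only [ENNReal.rpow_one]
          exact lintegral_weylKernel_left_le hl1 (by linarith) a)
        (fun u => by
          simp only [ENNReal.rpow_one]
          exact lintegral_weylKernel_right_le hl1 (by linarith) u)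
      simp only [← mul_assoc, ← weylKernel_mul_rpow] at h
      refine h.trans ?_
      rw [div_self hq0.ne', ENNReal.rpow_one, mul_assoc _ C]
      gcongr
      exact hCw w hw

/-- The contribution of the short side `a < 1` to the triangle integral. -/
theorem exists_lintegral_weylKernel_conv_rpow_le {p r l e : ℝ} (hp : 1 < p) (hpr : p ≤ r)
    (hl1 : l < 1) (hl : l < 2 + 1 / r - 2 / p) (he : 0 < e + (2 + 1 / r - 2 / p)) :
    ∃ C : ℝ≥0∞, C ≠ ⊤ ∧ ∀ w : ℝ → ℝ≥0∞, Measurable w →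
      ∫⁻ s, (∫⁻ b, (∫⁻ a, weylKernel l e |s - b| a * w a) * w b) ^ r ≤
        C * (∫⁻ a, w a ^ p) ^ (2 * r / p) := by
  have hp0 : 0 < p := by linarith
  have hr0 : 0 < r := by linarith
  have h1p : 1 / p < 1 := by rw [div_lt_one hp0]; exact hp
  have h1r : 1 / r ≤ 1 / p := one_div_le_one_div_of_le hp0 hpr
  have h1r0 : 0 < 1 / r := by positivity
  -- Convolving L^{1/t} with L^p lands in L^r. The inner fractional integral is therefore estimated
  -- in L^{1/t}, where 1/t ≥ 1 because p ≤ r.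
  set t : ℝ := 1 / r + (1 - 1 / p) with ht
  have ht0 : 0 < t := by linarith
  have hτ : 1 / (1 / t) + (1 - 1 / p) = 2 + 1 / r - 2 / p := by rw [one_div_one_div, ht]; ring
  obtain ⟨C, hC, hCw⟩ := exists_lintegral_weylKernel_mul_rpow_le (q := 1 / t) (l := l) (e := e) hp
    (by rw [one_le_div ht0]; linarith) hl1 (by rw [hτ]; exact hl) (by rw [hτ]; exact he)
  refine ⟨(2 * C) ^ (r * t), ENNReal.rpow_ne_top_of_nonneg (by positivity)
    (ENNReal.mul_ne_top (by simp) hC), fun w hw => ?_⟩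
  set Φ : ℝ → ℝ≥0∞ := fun u => ∫⁻ a, weylKernel l e u a * w a with hΦ
  have hΦm : Measurable Φ := ((measurable_weylKernel l e).mul
    (hw.comp measurable_snd)).lintegral_prod_right'
  have hA : ∀ c, ∫⁻ v, Φ |v - c| ^ (1 / t) ≤ 2 * (C * (∫⁻ a, w a ^ p) ^ (1 / t / p)) := fun c =>
    (lintegral_comp_abs_sub_le (hΦm.pow_const (1 / t)) c).trans (by gcongr; exact hCw w hw)
  have hk : Measurable (Function.uncurry fun s b : ℝ => Φ |s - b|) := hΦm.comp (by fun_prop)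
  have h := lintegral_lintegral_mul_rpow_le (μ := volume) (ν := volume) hk hw hp.le hpr
    (m := 1 / t) (by positivity) (by rw [one_div_one_div]) (fun b => hA b)
    (fun s => by simpa only [abs_sub_comm] using hA s)
  refine h.trans (le_of_eq ?_)
  set N := ∫⁻ a, w a ^ p
  have h1 : 0 ≤ r * (1 - 1 / p) := mul_nonneg hr0.le (by linarith)
  conv_lhs => rw [← ENNReal.rpow_one (2 * (C * N ^ (1 / t / p)))]
  rw [← ENNReal.rpow_mul, ← ENNReal.rpow_add_of_nonneg _ _ zero_le_one (by simpa using h1),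
    ← mul_assoc 2 C, ENNReal.mul_rpow_of_nonneg _ _ (by linarith), ← ENNReal.rpow_mul, mul_assoc,
    ← ENNReal.rpow_add_of_nonneg _ _ (by positivity) (by positivity)]
  have e1 : 1 + r * (1 - 1 / p) = r * t := by rw [ht]; field_simp
  rw [one_mul, e1]
  congr 2
  field_simp
  ring

end NSRenorm

/-! ### Decaying powers: triangles with long sides. -/

namespace NSRenorm

/-- The power `a ^ (-σ)` on `[1, ∞)`, extended by zero. -/
noncomputable def tailPow (σ : ℝ) : ℝ → ℝ≥0∞ :=
  (Ici 1).indicator fun a => ENNReal.ofReal (a ^ (-σ))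

theorem measurable_tailPow (σ : ℝ) : Measurable (tailPow σ) :=
  Measurable.indicator (by fun_prop) measurableSet_Ici

theorem tailPow_le_one {σ : ℝ} (hσ : 0 ≤ σ) (a : ℝ) : tailPow σ a ≤ 1 := by
  by_cases ha : a ∈ Ici (1 : ℝ)
  · rw [tailPow, indicator_of_mem ha, ← ENNReal.ofReal_one]
    exact ENNReal.ofReal_le_ofReal (Real.rpow_le_one_of_one_le_of_nonpos ha (by linarith))
  · rw [tailPow, indicator_of_notMem ha]; exact zero_le_one

theorem lintegral_tailPow_lt_top {σ : ℝ} (hσ : 1 < σ) : ∫⁻ a, tailPow σ a < ⊤ := by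
  have hi : IntegrableOn (fun v : ℝ => v ^ (-σ)) (Ioi 1) :=
    integrableOn_Ioi_rpow_of_lt (by linarith) one_pos
  rw [tailPow, lintegral_indicator measurableSet_Ici, ← restrict_Ioi_eq_restrict_Ici]
  exact hi.lintegral_lt_top

theorem tailPow_le_rpow {σ σ' θ : ℝ} (hθ : 0 ≤ θ) (h : σ' * θ ≤ σ) (a : ℝ) :
    tailPow σ a ≤ tailPow σ' a ^ θ := by
  by_cases ha : a ∈ Ici (1 : ℝ)
  · have ha' : (1 : ℝ) ≤ a := ha
    have ha0 : 0 ≤ a := by linarith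
    rw [tailPow, tailPow, indicator_of_mem ha, indicator_of_mem ha,
      ENNReal.ofReal_rpow_of_nonneg (by positivity) hθ, ← Real.rpow_mul ha0]
    exact ENNReal.ofReal_le_ofReal (Real.rpow_le_rpow_of_exponent_le ha' (by linarith))
  · rw [tailPow, indicator_of_notMem ha]; exact zero_le

/-- Hölder with exponents 1 - 2/p, 1/p, 1/p: for p ≥ 2 the product f g falls short of L^1, and the
decay of the power makes up the difference. -/
theorem exists_lintegral_tailPow_mul_le {p σ : ℝ} (hp : 2 ≤ p) (hσ0 : 0 ≤ σ)
    (hσ : 1 - 2 / p < σ) :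
    ∃ C : ℝ≥0∞, C ≠ ⊤ ∧ ∀ f g : ℝ → ℝ≥0∞, Measurable f → Measurable g →
      ∫⁻ a, tailPow σ a * (f a * g a) ≤
        C * ((∫⁻ a, f a ^ p) ^ (1 / p) * (∫⁻ a, g a ^ p) ^ (1 / p)) := by
  have hp0 : 0 < p := by linarith
  have hθ : 0 ≤ 1 - 2 / p := by rw [sub_nonneg, div_le_one hp0]; exact hp
  -- At p = 2 the Hölder exponent of the power vanishes and any σ' > 1 serves.
  obtain ⟨σ', h1, h2⟩ : ∃ σ', 1 < σ' ∧ σ' * (1 - 2 / p) ≤ σ := by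
    rcases hθ.eq_or_lt with h | h
    · exact ⟨2, one_lt_two, by rw [← h]; simpa⟩
    · exact ⟨σ / (1 - 2 / p), by rwa [one_lt_div h], by rw [div_mul_cancel₀ _ h.ne']⟩
  refine ⟨(∫⁻ a, tailPow σ' a) ^ (1 - 2 / p),
    ENNReal.rpow_ne_top_of_nonneg hθ (lintegral_tailPow_lt_top h1).ne, fun f g hf hg => ?_⟩
  have h := lintegral_rpow_mul_rpow_mul_rpow_le (μ := volume) (measurable_tailPow σ')
    (hf.pow_const p) (hg.pow_const p) hθ (by positivity : 0 ≤ 1 / p) (by positivity : 0 ≤ 1 / p)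
    (by ring)
  rw [mul_assoc] at h
  refine le_trans (lintegral_mono fun a => ?_) h
  rw [← ENNReal.rpow_mul, ← ENNReal.rpow_mul, mul_one_div_cancel hp0.ne', ENNReal.rpow_one,
    ENNReal.rpow_one, mul_assoc]
  gcongr
  exact tailPow_le_rpow hθ h2 a

/-- The contribution of the long sides `a ≥ 1` to the triangle integral. Here `ψ v` stands for
a translate or a reflection of `w`. -/
theorem exists_lintegral_truncPow_tailPow_rpow_le {p r l σ T L : ℝ} (hp : 1 < p) (hpr : p ≤ r)
    (hl1 : l < 1) (hl : l < 2 + 1 / r - 2 / p) (hσ0 : 0 ≤ σ)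
    (hσ : 1 - 2 / p < σ) (hT : 0 ≤ T) :
    ∃ C : ℝ≥0∞, C ≠ ⊤ ∧ ∀ (w : ℝ → ℝ≥0∞) (ψ : ℝ → ℝ → ℝ≥0∞), Measurable w →
      Measurable (Function.uncurry ψ) →
      (∀ a, ∫⁻ v, ψ v a ^ p ≤ ∫⁻ a, w a ^ p) → (∀ v, ∫⁻ a, ψ v a ^ p ≤ ∫⁻ a, w a ^ p) →
      ∫⁻ s in Icc 1 L, (∫⁻ v, truncPow (-l) T |s - v| *
          ∫⁻ a, tailPow σ a * (w a * ψ v a)) ^ r ≤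
        C * (∫⁻ a, w a ^ p) ^ (2 * r / p) := by
  have hp0 : 0 < p := by linarith
  have hr0 : 0 < r := by linarith
  rcases le_or_gt 2 p with h2p | h2p
  · obtain ⟨C, hC, hCw⟩ := exists_lintegral_tailPow_mul_le h2p hσ0 hσ
    set K := 2 * ENNReal.ofReal (T ^ (-l + 1) / (-l + 1))
    refine ⟨(K * C) ^ r * volume (Icc 1 L), ENNReal.mul_ne_top
      (ENNReal.rpow_ne_top_of_nonneg hr0.le (ENNReal.mul_ne_top (ENNReal.mul_ne_top (by simp)
        ENNReal.ofReal_ne_top) hC))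
      (by simp [Real.volume_Icc]), fun w ψ hw hψ _ hψ2 => ?_⟩
    set N := ∫⁻ a, w a ^ p
    have hH : ∀ v, ∫⁻ a, tailPow σ a * (w a * ψ v a) ≤ C * (N ^ (1 / p) * N ^ (1 / p)) := by
      intro v
      refine (hCw w (ψ v) hw (hψ.comp measurable_prodMk_left)).trans ?_
      gcongr
      exact hψ2 v
    have hT : ∀ s, ∫⁻ v, truncPow (-l) T |s - v| * ∫⁻ a, tailPow σ a * (w a * ψ v a) ≤
        K * (C * (N ^ (1 / p) * N ^ (1 / p))) := by
      intro s
      calc _ ≤ ∫⁻ v, truncPow (-l) T |s - v| * (C * (N ^ (1 / p) * N ^ (1 / p))) :=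
            lintegral_mono fun v => by gcongr; exact hH v
        _ ≤ _ := by
            have hm : Measurable fun v => truncPow (-l) T |s - v| :=
              (measurable_truncPow _ _).comp (by fun_prop)
            rw [lintegral_mul_const _ hm]
            gcongr
            simpa only [abs_sub_comm] using
              lintegral_truncPow_abs_sub_le (show -1 < -l by linarith) hT s
    calc _ ≤ ∫⁻ s in Icc 1 L, (K * (C * (N ^ (1 / p) * N ^ (1 / p)))) ^ r :=
          lintegral_mono fun s => by gcongr; exact hT s
      _ = _ := by
          rw [setLIntegral_const, ← mul_assoc K C, ENNReal.mul_rpow_of_nonneg _ _ hr0.le,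
            ← ENNReal.rpow_add_of_nonneg _ _ (by positivity) (by positivity), ← ENNReal.rpow_mul,
            show (1 / p + 1 / p) * r = 2 * r / p by ring]
          ring
  · have h1p : 1 / p < 1 := by rw [div_lt_one hp0]; exact hp
    have h2p' : 0 < 2 / p - 1 := by rw [sub_pos, one_lt_div hp0]; exact h2p
    -- The Young exponent of L^p * L^p, finite since p < 2. The decaying power is not needed here
    -- and is replaced by 1.
    set m₀ : ℝ := 1 / (2 / p - 1) with hm₀
    have hm₀0 : 0 < m₀ := by positivity
    have hm₀i : 1 / m₀ = 2 / p - 1 := by rw [hm₀, one_div_one_div]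
    have hpi : 2 / p = 2 * (1 / p) := by ring
    have hpm : p ≤ m₀ := by
      rw [← one_div_le_one_div hm₀0 hp0, hm₀i]; linarith
    have h1m : 1 ≤ m₀ := hp.le.trans hpm
    -- Young requires a target exponent at least m₀. If r < m₀, the bound is obtained in L^{m₀} and
    -- brought down to L^r on the bounded interval by Jensen.
    set R := max r m₀ with hR
    have hR0 : 0 < R := hr0.trans_le (le_max_left _ _)
    set t : ℝ := 1 / R + (1 - 1 / m₀) with ht
    have ht0 : 0 < t := by
      have : 0 < 1 / R := by positivity
      have : 1 / m₀ ≤ 1 := by rw [div_le_one hm₀0]; exact h1m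
      linarith
    have hlt : l < t := by
      rcases le_total r m₀ with h | h
      · rw [ht, hR, max_eq_right h]; linarith
      · rw [ht, hR, max_eq_left h, hm₀i]; linarith
    have hl' : l * (1 / t) < 1 := by rw [mul_one_div, div_lt_one ht0]; exact hlt
    set K := 2 * ENNReal.ofReal (T ^ (-l * (1 / t) + 1) / (-l * (1 / t) + 1)) with hK
    have hKt : K ≠ ⊤ := ENNReal.mul_ne_top (by simp) ENNReal.ofReal_ne_top
    have hAB : ∀ c, ∫⁻ v, truncPow (-l) T |v - c| ^ (1 / t) ≤ K := by
      intro c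
      simp only [truncPow_rpow (show 0 < 1 / t by positivity)]
      exact lintegral_truncPow_abs_sub_le (by linarith) hT c
    have he : 0 ≤ R * (1 - 1 / m₀) := by
      have : 1 / m₀ ≤ 1 := by rw [div_le_one hm₀0]; exact h1m
      exact mul_nonneg hR0.le (by linarith)
    have hrR : 0 ≤ 1 - r / R := by rw [sub_nonneg, div_le_one hR0]; exact le_max_left _ _
    refine ⟨(K * K ^ (R * (1 - 1 / m₀))) ^ (r / R) * volume (Icc 1 L) ^ (1 - r / R), ?_,
      fun w ψ hw hψ hψ1 hψ2 => ?_⟩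
    · exact ENNReal.mul_ne_top (ENNReal.rpow_ne_top_of_nonneg (by positivity)
        (ENNReal.mul_ne_top hKt (ENNReal.rpow_ne_top_of_nonneg he hKt)))
        (ENNReal.rpow_ne_top_of_nonneg hrR (by simp [Real.volume_Icc]))
    set N := ∫⁻ a, w a ^ p with hN
    set H : ℝ → ℝ≥0∞ := fun v => ∫⁻ a, tailPow σ a * (w a * ψ v a) with hH
    have hHm : Measurable H :=
      (((measurable_tailPow σ).comp measurable_snd).mul
        ((hw.comp measurable_snd).mul hψ)).lintegral_prod_right'
    have hHN : ∫⁻ v, H v ^ m₀ ≤ N ^ (2 * m₀ / p) := by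
      have h := lintegral_lintegral_mul_rpow_le (μ := volume) (ν := volume) hψ hw hp.le hpm hp0
        (by rw [hm₀i]; ring) hψ1 hψ2
      have h1 : 0 ≤ m₀ * (1 - 1 / p) := mul_nonneg hm₀0.le (by linarith)
      have h2 : (1 : ℝ) + m₀ * (1 - 1 / p) + m₀ / p = 2 * m₀ / p := by
        have : m₀ * (2 / p - 1) = 1 := by rw [← hm₀i]; field_simp
        linear_combination -this
      have h3 : N * N ^ (m₀ * (1 - 1 / p)) * N ^ (m₀ / p) = N ^ (2 * m₀ / p) := by
        rw [← h2, ENNReal.rpow_add_of_nonneg _ _ (by linarith) (by positivity),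
          ENNReal.rpow_add_of_nonneg _ _ zero_le_one h1, ENNReal.rpow_one]
      rw [← hN, h3] at h
      refine le_trans (lintegral_mono fun v => ?_) h
      gcongr
      calc H v ≤ ∫⁻ a, 1 * (w a * ψ v a) := lintegral_mono fun a => by
            gcongr; exact tailPow_le_one hσ0 a
        _ = _ := lintegral_congr fun a => by rw [one_mul, mul_comm]
    have hk : Measurable (Function.uncurry fun s v : ℝ => truncPow (-l) T |s - v|) :=
      (measurable_truncPow _ _).comp (by fun_prop)
    have h := lintegral_lintegral_mul_rpow_le (μ := volume) (ν := volume) hk hHm h1m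
      (le_max_right r m₀) (m := 1 / t) (by positivity) (one_div_one_div t).symm
      (A := K) (B := K) (fun a => hAB a) (fun s => by simpa only [abs_sub_comm] using hAB s)
    have hTm : Measurable fun s => ∫⁻ v, truncPow (-l) T |s - v| * H v :=
      (hk.mul (hHm.comp measurable_snd)).lintegral_prod_right'
    calc ∫⁻ s in Icc 1 L, (∫⁻ v, truncPow (-l) T |s - v| * H v) ^ r
        ≤ (∫⁻ s in Icc 1 L, (∫⁻ v, truncPow (-l) T |s - v| * H v) ^ R) ^ (r / R) *
          (volume.restrict (Icc 1 L)) univ ^ (1 - r / R) :=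
          lintegral_rpow_le_of_le hTm hr0 (le_max_left _ _)
      _ ≤ (K * K ^ (R * (1 - 1 / m₀)) * (N ^ (2 * m₀ / p)) ^ (R / m₀)) ^ (r / R) *
          volume (Icc 1 L) ^ (1 - r / R) := by
          rw [Measure.restrict_apply_univ]
          gcongr
          refine (setLIntegral_le_lintegral _ _).trans (h.trans ?_)
          gcongr
      _ = _ := by
          rw [ENNReal.mul_rpow_of_nonneg _ _ (by positivity : 0 ≤ r / R), ← ENNReal.rpow_mul,
            ← ENNReal.rpow_mul,
            show 2 * m₀ / p * (R / m₀ * (r / R)) = 2 * r / p by field_simp]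
          ring

end NSRenorm

/-! ### The bilinear form on triangles. -/

namespace NSRenorm

/-- The kernel of the radial convolution in bipolar coordinates, on triangles with sides
`a ≤ b` and `s`. -/
noncomputable def triKernel (l e f s a b : ℝ) : ℝ≥0∞ :=
  if 0 < a ∧ a ≤ b ∧ |b - s| < a then
    ENNReal.ofReal (a ^ (e + l) * b ^ (f - l) * (a - |b - s|) ^ (-l)) else 0

theorem measurable_triKernel (l e f s : ℝ) :
    Measurable (Function.uncurry (triKernel l e f s)) := by
  unfold triKernel Function.uncurry
  refine Measurable.ite ?_ (by fun_prop) measurable_const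
  exact (measurableSet_lt measurable_const measurable_fst).inter
    ((measurableSet_le measurable_fst measurable_snd).inter
      (measurableSet_lt (by fun_prop) measurable_fst))

theorem rpow_le_add_of_mem_Icc {a b x : ℝ} (ha : 0 < a) (hab : x ∈ Icc a b) (q : ℝ) :
    x ^ q ≤ a ^ q + b ^ q := by
  have hx : 0 < x := ha.trans_le hab.1
  have hb : 0 < b := hx.trans_le hab.2
  rcases le_total 0 q with h | h
  · have := Real.rpow_le_rpow hx.le hab.2 h
    have : 0 ≤ a ^ q := by positivity
    linarith
  · have := Real.rpow_le_rpow_of_nonpos ha hab.1 h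
    have : 0 ≤ b ^ q := by positivity
    linarith

/-- With s in [1, L], a < 1 confines b to a compact range and leaves the fractional kernel. If a ≥
1, then b/a is bounded, the powers of a and b combine to a^{-σ}, and the singular factor is a
truncated power of the distance from s to b - a or b + a. -/
theorem exists_triKernel_le {l e f σ L : ℝ} (hσ : e + f = -σ) :
    ∃ C : ℝ, ∀ s ∈ Icc 1 L, ∀ a b, triKernel l e f s a b ≤
      ENNReal.ofReal C * (weylKernel l e |s - b| a +
        truncPow (-l) (3 * L) |s - (b - a)| * tailPow σ a +
        truncPow (-l) (3 * L) |s - (b + a)| * tailPow σ a) := by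
  set C₀ : ℝ := (1 / 2 : ℝ) ^ (f - l) + (L + 1) ^ (f - l) with hC₀
  set C₁ : ℝ := 1 ^ (f - l) + (L + 1) ^ (f - l) with hC₁
  refine ⟨max C₀ C₁, fun s hs a b => ?_⟩
  unfold triKernel
  split_ifs with h
  swap
  · exact zero_le
  obtain ⟨ha, hab, hbs⟩ := h
  have hbs' := abs_lt.1 hbs
  have hb : 0 < b := ha.trans_le hab
  have hL : 1 ≤ L := hs.1.trans hs.2
  have hd : 0 < a - |b - s| := by linarith
  rcases lt_or_ge a 1 with ha1 | ha1
  -- From b ≥ a and b > s - a one gets 2b > s ≥ 1; above, b < s + a < L + 1.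
  · have hb' : b ∈ Icc (1 / 2) (L + 1) :=
      ⟨by linarith [hs.1], by linarith [hs.2]⟩
    rw [weylKernel, if_pos ⟨abs_nonneg _, by rwa [abs_sub_comm], ha1⟩, add_assoc, mul_add]
    refine le_trans ?_ le_self_add
    have hCn : 0 ≤ max C₀ C₁ := le_trans (by positivity) (le_max_left _ _)
    rw [← ENNReal.ofReal_mul hCn]
    apply ENNReal.ofReal_le_ofReal
    have h1 : b ^ (f - l) ≤ max C₀ C₁ :=
      (rpow_le_add_of_mem_Icc (by norm_num) hb' _).trans (le_max_left _ _)
    rw [abs_sub_comm s b]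
    calc a ^ (e + l) * b ^ (f - l) * (a - |b - s|) ^ (-l)
        = b ^ (f - l) * (a ^ (e + l) * (a - |b - s|) ^ (-l)) := by ring
      _ ≤ _ := by gcongr
  · have hCn : 0 ≤ max C₀ C₁ := le_trans (by positivity) (le_max_right _ _)
    -- Here b < s + a ≤ L + a ≤ (L + 1) a, since a ≥ 1.
    have hq : b / a ∈ Icc 1 (L + 1) := by
      constructor
      · rwa [one_le_div ha]
      · rw [div_le_iff₀ ha]; nlinarith [hs.2]
    have h1 : a ^ (e + l) * b ^ (f - l) ≤ max C₀ C₁ * a ^ (-σ) := by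
      calc a ^ (e + l) * b ^ (f - l) = a ^ (e + l) * ((b / a) ^ (f - l) * a ^ (f - l)) := by
            rw [← Real.mul_rpow (by positivity) ha.le, div_mul_cancel₀ _ ha.ne']
        _ = (b / a) ^ (f - l) * a ^ (-σ) := by
            rw [← hσ, mul_left_comm, ← Real.rpow_add ha]; ring_nf
        _ ≤ _ := by
            gcongr
            exact (rpow_le_add_of_mem_Icc one_pos hq _).trans (le_max_right _ _)
    have key : ∀ c, c = a - |b - s| → |c| < 3 * L →
        ENNReal.ofReal (a ^ (e + l) * b ^ (f - l) * (a - |b - s|) ^ (-l)) ≤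
          ENNReal.ofReal (max C₀ C₁) * (truncPow (-l) (3 * L) c * tailPow σ a) := by
      intro c hc hcL
      have hc0 : 0 < c := by rw [hc]; exact hd
      rw [abs_of_pos hc0] at hcL
      rw [truncPow, indicator_of_mem (show c ∈ Ioo 0 (3 * L) from ⟨hc0, hcL⟩), tailPow,
        indicator_of_mem (show a ∈ Ici 1 from ha1), ← ENNReal.ofReal_mul (by positivity),
        ← ENNReal.ofReal_mul hCn, ← hc]
      apply ENNReal.ofReal_le_ofReal
      calc a ^ (e + l) * b ^ (f - l) * c ^ (-l)
          ≤ (max C₀ C₁ * a ^ (-σ)) * c ^ (-l) := by gcongr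
        _ = _ := by ring
    rcases le_total s b with hsb | hsb
    · have h2 : |s - (b - a)| = a - |b - s| := by
        rw [abs_of_nonneg (show 0 ≤ b - s by linarith), abs_of_nonneg (by linarith)]; ring
      refine (key _ h2 ?_).trans ?_
      · rw [abs_abs, h2, abs_of_nonneg (show 0 ≤ b - s by linarith)]
        linarith [hs.2]
      · gcongr
        rw [add_assoc, add_left_comm]
        exact le_self_add
    · have h2 : |s - (b + a)| = a - |b - s| := by
        rw [abs_of_nonpos (show b - s ≤ 0 by linarith), abs_of_nonpos (by linarith)]; ring
      refine (key _ h2 ?_).trans ?_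
      · rw [abs_abs, h2, abs_of_nonpos (show b - s ≤ 0 by linarith)]
        linarith [hs.2]
      · gcongr
        exact le_add_self

theorem lintegral_lintegral_mul_swap {k : ℝ → ℝ → ℝ≥0∞} (hk : Measurable (Function.uncurry k))
    {φ : ℝ → ℝ≥0∞} (hφ : Measurable φ) :
    ∫⁻ a, ∫⁻ v, φ v * k v a = ∫⁻ v, φ v * ∫⁻ a, k v a := by
  have hm : Measurable fun z : ℝ × ℝ => φ z.1 * k z.1 z.2 := (hφ.comp measurable_fst).mul hk
  have hs := lintegral_lintegral_swap (μ := (volume : Measure ℝ)) (ν := (volume : Measure ℝ))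
    (f := fun v a => φ v * k v a) hm.aemeasurable
  rw [← hs]
  refine lintegral_congr fun v => ?_
  have hkv : Measurable (k v) := hk.comp measurable_prodMk_left
  rw [lintegral_const_mul _ hkv]

theorem lintegral_lintegral_add_left {f : ℝ → ℝ → ℝ≥0∞} (hf : Measurable (Function.uncurry f))
    (g : ℝ → ℝ → ℝ≥0∞) :
    ∫⁻ a, ∫⁻ b, (f a b + g a b) = (∫⁻ a, ∫⁻ b, f a b) + ∫⁻ a, ∫⁻ b, g a b := by
  have hm : Measurable fun a => ∫⁻ b, f a b := hf.lintegral_prod_right'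
  rw [← lintegral_add_left hm]
  refine lintegral_congr fun a => ?_
  have ha : Measurable (f a) := hf.comp measurable_prodMk_left
  rw [lintegral_add_left ha]

/-- The kernel splits into three pieces. In the last two, v = b - a or v = b + a replaces b, so that
w(b) becomes a translate or a reflection of w; both preserve the L^p integral in each variable. -/
theorem exists_lintegral_triKernel_rpow_le {p r l e f σ : ℝ} (hp : 1 < p) (hpr : p ≤ r)
    (hl1 : l < 1) (hl : l < 2 + 1 / r - 2 / p) (he : 0 < e + (2 + 1 / r - 2 / p))
    (hef : e + f = -σ) (hσ0 : 0 ≤ σ) (hσ : 1 - 2 / p < σ) (L : ℝ) :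
    ∃ C : ℝ≥0∞, C ≠ ⊤ ∧ ∀ w : ℝ → ℝ≥0∞, Measurable w →
      ∫⁻ s in Icc 1 L, (∫⁻ a, ∫⁻ b, triKernel l e f s a b * (w a * w b)) ^ r ≤
        C * (∫⁻ a, w a ^ p) ^ (2 * r / p) := by
  rcases lt_or_ge L 1 with hL | hL
  · exact ⟨0, by simp, fun w _ => by simp [Icc_eq_empty_of_lt hL]⟩
  have hr0 : 0 < r := by linarith
  have hr1 : 1 ≤ r := by linarith
  obtain ⟨C₁, hC₁, h₁⟩ := exists_lintegral_weylKernel_conv_rpow_le hp hpr hl1 hl he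
  obtain ⟨C₂, hC₂, h₂⟩ := exists_lintegral_truncPow_tailPow_rpow_le (L := L) (T := 3 * L) hp hpr
    hl1 hl hσ0 hσ (by linarith)
  obtain ⟨C, hC⟩ := exists_triKernel_le (l := l) (L := L) hef
  refine ⟨ENNReal.ofReal C ^ r * (2 ^ (r - 1) * (2 ^ (r - 1) * (C₁ + C₂) + C₂)), ?_,
    fun w hw => ?_⟩
  · have h2 : (2 : ℝ≥0∞) ^ (r - 1) ≠ ⊤ :=
      ENNReal.rpow_ne_top_of_nonneg (by linarith) (by simp)
    exact ENNReal.mul_ne_top (ENNReal.rpow_ne_top_of_nonneg hr0.le ENNReal.ofReal_ne_top)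
      (ENNReal.mul_ne_top h2 (ENNReal.add_ne_top.2
        ⟨ENNReal.mul_ne_top h2 (ENNReal.add_ne_top.2 ⟨hC₁, hC₂⟩), hC₂⟩))
  set N := ∫⁻ a, w a ^ p with hN
  set P : ℝ → ℝ≥0∞ := fun x => truncPow (-l) (3 * L) |x| with hP
  have hPm : Measurable P := (measurable_truncPow _ _).comp (by fun_prop)
  have ht := measurable_tailPow σ
  have hK := measurable_weylKernel l e
  set X₁ : ℝ → ℝ≥0∞ := fun s => ∫⁻ b, (∫⁻ a, weylKernel l e |s - b| a * w a) * w b with hX₁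
  set X₂ : ℝ → ℝ≥0∞ := fun s => ∫⁻ v, P (s - v) * ∫⁻ a, tailPow σ a * (w a * w (v + a)) with hX₂
  set X₃ : ℝ → ℝ≥0∞ := fun s => ∫⁻ v, P (s - v) * ∫⁻ a, tailPow σ a * (w a * w (v - a)) with hX₃
  have hm₂ : Measurable (Function.uncurry fun v a : ℝ => tailPow σ a * (w a * w (v + a))) :=
    (ht.comp measurable_snd).mul ((hw.comp measurable_snd).mul (hw.comp (by fun_prop)))
  have hm₃ : Measurable (Function.uncurry fun v a : ℝ => tailPow σ a * (w a * w (v - a))) :=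
    (ht.comp measurable_snd).mul ((hw.comp measurable_snd).mul (hw.comp (by fun_prop)))
  have hX₁m : Measurable X₁ := by
    have h : Measurable fun z : (ℝ × ℝ) × ℝ => weylKernel l e |z.1.1 - z.1.2| z.2 * w z.2 :=
      (hK.comp (by fun_prop : Measurable fun z : (ℝ × ℝ) × ℝ => (|z.1.1 - z.1.2|, z.2))).mul
        (hw.comp measurable_snd)
    have h' : Measurable fun z : ℝ × ℝ => (∫⁻ a, weylKernel l e |z.1 - z.2| a * w a) * w z.2 :=
      h.lintegral_prod_right'.mul (hw.comp measurable_snd)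
    exact h'.lintegral_prod_right'
  have hX₂m : Measurable X₂ := by
    have h : Measurable fun z : ℝ × ℝ =>
        P (z.1 - z.2) * ∫⁻ a, tailPow σ a * (w a * w (z.2 + a)) :=
      (hPm.comp (by fun_prop)).mul (hm₂.lintegral_prod_right'.comp measurable_snd)
    exact h.lintegral_prod_right'
  have hX₃m : Measurable X₃ := by
    have h : Measurable fun z : ℝ × ℝ =>
        P (z.1 - z.2) * ∫⁻ a, tailPow σ a * (w a * w (z.2 - a)) :=
      (hPm.comp (by fun_prop)).mul (hm₃.lintegral_prod_right'.comp measurable_snd)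
    exact h.lintegral_prod_right'
  have key : ∀ s ∈ Icc 1 L, ∫⁻ a, ∫⁻ b, triKernel l e f s a b * (w a * w b) ≤
      ENNReal.ofReal C * (X₁ s + X₂ s + X₃ s) := by
    intro s hs
    have hY₁ : Measurable (Function.uncurry fun a b : ℝ =>
        weylKernel l e |s - b| a * (w a * w b)) :=
      (hK.comp (by fun_prop : Measurable fun z : ℝ × ℝ => (|s - z.2|, z.1))).mul
        ((hw.comp measurable_fst).mul (hw.comp measurable_snd))
    have hY₂ : Measurable (Function.uncurry fun a b : ℝ =>
        P (s - (b - a)) * (tailPow σ a * (w a * w b))) :=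
      (hPm.comp (by fun_prop)).mul ((ht.comp measurable_fst).mul
        ((hw.comp measurable_fst).mul (hw.comp measurable_snd)))
    calc ∫⁻ a, ∫⁻ b, triKernel l e f s a b * (w a * w b)
        ≤ ∫⁻ a, ∫⁻ b, ENNReal.ofReal C * (weylKernel l e |s - b| a * (w a * w b) +
          P (s - (b - a)) * (tailPow σ a * (w a * w b)) +
          P (s - (b + a)) * (tailPow σ a * (w a * w b))) := by
          refine lintegral_mono fun a => lintegral_mono fun b => ?_
          refine (mul_le_mul_left (hC s hs a b) _).trans (le_of_eq ?_)
          simp only [hP]; ring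
      _ = ENNReal.ofReal C * ((∫⁻ a, ∫⁻ b, weylKernel l e |s - b| a * (w a * w b)) +
          (∫⁻ a, ∫⁻ b, P (s - (b - a)) * (tailPow σ a * (w a * w b))) +
          (∫⁻ a, ∫⁻ b, P (s - (b + a)) * (tailPow σ a * (w a * w b)))) := by
          simp only [lintegral_const_mul' _ _ ENNReal.ofReal_ne_top]
          congr 1
          have hY₁₂ : Measurable (Function.uncurry fun a b : ℝ =>
              weylKernel l e |s - b| a * (w a * w b) +
                P (s - (b - a)) * (tailPow σ a * (w a * w b))) := hY₁.add hY₂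
          rw [← lintegral_lintegral_add_left hY₁, ← lintegral_lintegral_add_left hY₁₂]
      _ = _ := by
          have e₁ : ∫⁻ a, ∫⁻ b, weylKernel l e |s - b| a * (w a * w b) = X₁ s := by
            rw [lintegral_lintegral_swap hY₁.aemeasurable]
            refine lintegral_congr fun b => ?_
            have h1 : Measurable fun a => weylKernel l e |s - b| a * w a :=
              (hK.comp measurable_prodMk_left).mul hw
            rw [← lintegral_mul_const _ h1]
            exact lintegral_congr fun a => by ring
          have hPs : Measurable fun v => P (s - v) := hPm.comp (by fun_prop)
          have e₂ : ∫⁻ a, ∫⁻ b, P (s - (b - a)) * (tailPow σ a * (w a * w b)) = X₂ s := by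
            simp only [hX₂]
            rw [← lintegral_lintegral_mul_swap hm₂ hPs]
            refine lintegral_congr fun a => ?_
            rw [← lintegral_add_right_eq_self _ a]
            simp
          have e₃ : ∫⁻ a, ∫⁻ b, P (s - (b + a)) * (tailPow σ a * (w a * w b)) = X₃ s := by
            simp only [hX₃]
            rw [← lintegral_lintegral_mul_swap hm₃ hPs]
            refine lintegral_congr fun a => ?_
            rw [← lintegral_sub_right_eq_self _ a]
            simp
          rw [e₁, e₂, e₃]
  have hB₁ : ∫⁻ s in Icc 1 L, X₁ s ^ r ≤ C₁ * N ^ (2 * r / p) :=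
    (setLIntegral_le_lintegral _ _).trans (h₁ w hw)
  have hB₂ : ∫⁻ s in Icc 1 L, X₂ s ^ r ≤ C₂ * N ^ (2 * r / p) :=
    h₂ w (fun v a => w (v + a)) hw (hw.comp (by fun_prop))
      (fun a => (lintegral_add_right_eq_self (fun v => w v ^ p) a).le)
      (fun v => (lintegral_add_left_eq_self (fun a => w a ^ p) v).le)
  have hB₃ : ∫⁻ s in Icc 1 L, X₃ s ^ r ≤ C₂ * N ^ (2 * r / p) :=
    h₂ w (fun v a => w (v - a)) hw (hw.comp (by fun_prop))
      (fun a => (lintegral_sub_right_eq_self (fun v => w v ^ p) a).le)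
      (fun v => (lintegral_sub_left_eq_self (fun a => w a ^ p) v).le)
  calc ∫⁻ s in Icc 1 L, (∫⁻ a, ∫⁻ b, triKernel l e f s a b * (w a * w b)) ^ r
      ≤ ∫⁻ s in Icc 1 L, ENNReal.ofReal C ^ r * (2 ^ (r - 1) *
          (2 ^ (r - 1) * (X₁ s ^ r + X₂ s ^ r) + X₃ s ^ r)) := by
        refine setLIntegral_mono' measurableSet_Icc fun s hs => ?_
        calc _ ≤ (ENNReal.ofReal C * (X₁ s + X₂ s + X₃ s)) ^ r := by gcongr; exact key s hs
          _ = ENNReal.ofReal C ^ r * (X₁ s + X₂ s + X₃ s) ^ r :=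
              ENNReal.mul_rpow_of_nonneg _ _ hr0.le
          _ ≤ _ := by
              gcongr
              refine (ENNReal.rpow_add_le_mul_rpow_add_rpow _ _ hr1).trans ?_
              gcongr
              exact ENNReal.rpow_add_le_mul_rpow_add_rpow _ _ hr1
    _ = ENNReal.ofReal C ^ r * (2 ^ (r - 1) * (2 ^ (r - 1) * ((∫⁻ s in Icc 1 L, X₁ s ^ r) +
          ∫⁻ s in Icc 1 L, X₂ s ^ r) + ∫⁻ s in Icc 1 L, X₃ s ^ r)) := by
        have m1 := hX₁m.pow_const r
        have m2 := hX₂m.pow_const r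
        have m12 : Measurable fun s => 2 ^ (r - 1) * (X₁ s ^ r + X₂ s ^ r) :=
          (m1.add m2).const_mul _
        have h2 : (2 : ℝ≥0∞) ^ (r - 1) ≠ ⊤ :=
          ENNReal.rpow_ne_top_of_nonneg (by linarith) (by simp)
        rw [lintegral_const_mul' _ _ (ENNReal.rpow_ne_top_of_nonneg hr0.le ENNReal.ofReal_ne_top),
          lintegral_const_mul' _ _ h2, lintegral_add_left m12, lintegral_const_mul' _ _ h2,
          lintegral_add_left m1]
    _ ≤ ENNReal.ofReal C ^ r * (2 ^ (r - 1) * (2 ^ (r - 1) * (C₁ * N ^ (2 * r / p) +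
          C₂ * N ^ (2 * r / p)) + C₂ * N ^ (2 * r / p))) := by gcongr
    _ = _ := by ring

end NSRenorm

/-! ### Polar and cylindrical coordinates for radial convolutions. -/

namespace NSRenorm

theorem lintegral_fun_norm_addHaar {E : Type*} [NormedAddCommGroup E] [NormedSpace ℝ E]
    [MeasurableSpace E] [BorelSpace E] [FiniteDimensional ℝ E] [Nontrivial E] (μ : Measure E)
    [μ.IsAddHaarMeasure] {f : ℝ → ℝ≥0∞} (hf : Measurable f) :
    ∫⁻ x, f ‖x‖ ∂μ = μ.toSphere univ *
      ∫⁻ a in Ioi (0 : ℝ), ENNReal.ofReal (a ^ (Module.finrank ℝ E - 1)) * f a := by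
  have hm : Measurable fun x : Ioi (0 : ℝ) => f x := hf.comp measurable_subtype_coe
  calc ∫⁻ x, f ‖x‖ ∂μ = ∫⁻ x : ({(0 : E)}ᶜ : Set E), f ‖x.1‖ ∂(μ.comap (↑)) := by
        rw [lintegral_subtype_comap (measurableSet_singleton _).compl fun x => f ‖x‖,
          restrict_compl_singleton]
    _ = ∫⁻ x, f x.2 ∂μ.toSphere.prod (.volumeIoiPow (Module.finrank ℝ E - 1)) := by
        simpa using μ.measurePreserving_homeomorphUnitSphereProd.lintegral_comp_emb
          (Homeomorph.measurableEmbedding _) (f ∘ Subtype.val ∘ Prod.snd)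
    _ = μ.toSphere univ * ∫⁻ x : Ioi (0 : ℝ), f x ∂.volumeIoiPow (Module.finrank ℝ E - 1) := by
        have hm2 : Measurable fun x : Metric.sphere (0 : E) 1 × Ioi (0 : ℝ) => f x.2 :=
          hm.comp measurable_snd
        rw [lintegral_prod _ hm2.aemeasurable]
        simp [mul_comm]
    _ = _ := by
        congr 1
        rw [Measure.volumeIoiPow, lintegral_withDensity_eq_lintegral_mul _ (by fun_prop) hm]
        exact lintegral_subtype_comap measurableSet_Ioi
          fun a => ENNReal.ofReal (a ^ (Module.finrank ℝ E - 1)) * f a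

/-- The vector with first coordinate `z` and remaining coordinates `y`. -/
def consVec {n : ℕ} (q : ℝ × EuclideanSpace ℝ (Fin n)) : EuclideanSpace ℝ (Fin (n + 1)) :=
  WithLp.toLp 2 (Fin.cons q.1 q.2.ofLp : Fin (n + 1) → ℝ)

theorem measurePreserving_consVec (n : ℕ) :
    MeasurePreserving (consVec (n := n)) (volume.prod volume) volume := by
  have h1 : MeasurePreserving (Prod.map (id : ℝ → ℝ)
      (WithLp.ofLp : EuclideanSpace ℝ (Fin n) → Fin n → ℝ)) (volume.prod volume)
      (volume.prod volume) := (MeasurePreserving.id volume).prod (PiLp.volume_preserving_ofLp _)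
  have h2 := (volume_preserving_piFinSuccAbove (fun _ : Fin (n + 1) => ℝ) 0).symm
  have h3 : consVec (n := n) = (WithLp.toLp 2 ∘
      (MeasurableEquiv.piFinSuccAbove (fun _ : Fin (n + 1) => ℝ) 0).symm) ∘
      Prod.map id WithLp.ofLp := by
    funext q
    simp [consVec, MeasurableEquiv.piFinSuccAbove]
    rfl
  rw [h3]
  exact ((PiLp.volume_preserving_toLp (Fin (n + 1))).comp h2).comp h1

theorem norm_consVec {n : ℕ} (q : ℝ × EuclideanSpace ℝ (Fin n)) :
    ‖consVec q‖ = √(q.1 ^ 2 + ‖q.2‖ ^ 2) := by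
  rw [EuclideanSpace.norm_eq, EuclideanSpace.real_norm_sq_eq, Fin.sum_univ_succ]
  simp [consVec]

theorem single_sub_consVec {n : ℕ} (s : ℝ) (q : ℝ × EuclideanSpace ℝ (Fin n)) :
    EuclideanSpace.single 0 s - consVec q = consVec (s - q.1, -q.2) := by
  ext i
  refine Fin.cases ?_ (fun j => ?_) i <;> simp [consVec]

/-- The convolution square of the radial function with profile `F`, at a point of norm `|s|`. -/
noncomputable def radConv (n : ℕ) (F : ℝ → ℝ≥0∞) (s : ℝ) : ℝ≥0∞ :=
  ∫⁻ y : EuclideanSpace ℝ (Fin (n + 1)), F ‖y‖ * F ‖EuclideanSpace.single 0 s - y‖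

theorem lintegral_norm_mul_norm_sub {n : ℕ} (F : ℝ → ℝ≥0∞)
    (x : EuclideanSpace ℝ (Fin (n + 1))) :
    ∫⁻ y, F ‖y‖ * F ‖x - y‖ = radConv n F ‖x‖ := by
  set v : EuclideanSpace ℝ (Fin (n + 1)) := EuclideanSpace.single 0 ‖x‖ with hv
  have hvx : ‖x‖ = ‖v‖ := by simp [hv]
  -- The reflection in the hyperplane orthogonal to x - v carries x to v and preserves norms and
  -- volume.
  set e := (Submodule.span ℝ {x - v})ᗮ.reflection with he
  have hex : e x = v := Submodule.reflection_sub hvx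
  refine Eq.trans (lintegral_congr fun y => ?_)
    ((LinearIsometryEquiv.measurePreserving e).lintegral_comp_emb
      e.toHomeomorph.measurableEmbedding (fun y => F ‖y‖ * F ‖v - y‖))
  rw [LinearIsometryEquiv.norm_map, ← hex, ← map_sub, LinearIsometryEquiv.norm_map]

/-- Cylindrical coordinates about the axis through the base point: z is the coordinate along the
axis, ρ the distance to it. -/
theorem radConv_eq {n : ℕ} (hn : 1 ≤ n) {F : ℝ → ℝ≥0∞} (hF : Measurable F) (s : ℝ) :
    radConv n F s = (volume : Measure (EuclideanSpace ℝ (Fin n))).toSphere univ *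
      ∫⁻ z : ℝ, ∫⁻ ρ in Ioi (0 : ℝ), ENNReal.ofReal (ρ ^ (n - 1)) *
        (F √(z ^ 2 + ρ ^ 2) * F √((s - z) ^ 2 + ρ ^ 2)) := by
  have : Nonempty (Fin n) := ⟨⟨0, hn⟩⟩
  have hm : Measurable fun y : EuclideanSpace ℝ (Fin (n + 1)) =>
      F ‖y‖ * F ‖EuclideanSpace.single 0 s - y‖ :=
    (hF.comp measurable_norm).mul (hF.comp (by fun_prop))
  have hm2 : ∀ z : ℝ, Measurable fun ρ : ℝ => F √(z ^ 2 + ρ ^ 2) * F √((s - z) ^ 2 + ρ ^ 2) :=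
    fun z => (hF.comp (by fun_prop)).mul (hF.comp (by fun_prop))
  have hm3 : Measurable fun z : ℝ => ∫⁻ ρ in Ioi (0 : ℝ), ENNReal.ofReal (ρ ^ (n - 1)) *
        (F √(z ^ 2 + ρ ^ 2) * F √((s - z) ^ 2 + ρ ^ 2)) := by
    have h : Measurable fun q : ℝ × ℝ => ENNReal.ofReal (q.2 ^ (n - 1)) *
        (F √(q.1 ^ 2 + q.2 ^ 2) * F √((s - q.1) ^ 2 + q.2 ^ 2)) := by
      refine Measurable.mul (by fun_prop) ?_
      exact (hF.comp (by fun_prop)).mul (hF.comp (by fun_prop))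
    exact h.lintegral_prod_right'
  have hmc : Measurable fun q : ℝ × EuclideanSpace ℝ (Fin n) =>
      F ‖consVec q‖ * F ‖EuclideanSpace.single 0 s - consVec q‖ :=
    hm.comp (measurePreserving_consVec n).measurable
  rw [radConv, ← (measurePreserving_consVec n).lintegral_comp hm,
    lintegral_prod _ hmc.aemeasurable, ← lintegral_const_mul _ hm3]
  refine lintegral_congr fun z => ?_
  simp only [single_sub_consVec, norm_consVec, norm_neg]
  have := lintegral_fun_norm_addHaar (volume : Measure (EuclideanSpace ℝ (Fin n))) (hm2 z)
  rw [finrank_euclideanSpace_fin] at this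
  exact this

end NSRenorm

/-! ### Bipolar coordinates. -/

namespace NSRenorm

/-- Substituting a² = z² + ρ² gives ρ^{n-1} dρ = (a² - z²)^{(n-2)/2} a da. Only an upper bound is
required, so it is enough that the map is injective with image inside the stated range. -/
theorem lintegral_polar_change_le {n : ℕ} (hn : 1 ≤ n) (Ψ : ℝ → ℝ≥0∞) (z : ℝ) :
    ∫⁻ ρ in Ioi (0 : ℝ), ENNReal.ofReal (ρ ^ (n - 1)) * Ψ √(z ^ 2 + ρ ^ 2) ≤
      ∫⁻ a in Ioi |z|, ENNReal.ofReal (a * (a ^ 2 - z ^ 2) ^ (((n : ℝ) - 2) / 2)) * Ψ a := by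
  set f : ℝ → ℝ := fun ρ => √(z ^ 2 + ρ ^ 2) with hf
  have hpos : ∀ ρ ∈ Ioi (0 : ℝ), 0 < z ^ 2 + ρ ^ 2 := fun ρ hρ => by
    have : 0 < ρ := hρ
    positivity
  have hd : ∀ ρ ∈ Ioi (0 : ℝ), HasDerivWithinAt f (ρ / f ρ) (Ioi 0) ρ := by
    intro ρ hρ
    have h := ((((hasDerivAt_id ρ).pow 2).const_add (z ^ 2)).sqrt (hpos ρ hρ).ne')
    refine (h.congr_deriv ?_).hasDerivWithinAt
    simp only [id, hf]
    have : 0 < √(z ^ 2 + ρ ^ 2) := Real.sqrt_pos.2 (hpos ρ hρ)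
    simp only [Pi.pow_apply, id]
    field_simp
    norm_num
  have hinj : InjOn f (Ioi 0) := by
    intro x hx y hy hxy
    have h := congrArg (· ^ 2) hxy
    simp only [hf] at h
    rw [Real.sq_sqrt (hpos x hx).le, Real.sq_sqrt (hpos y hy).le] at h
    have hx' : 0 < x := hx
    have hy' : 0 < y := hy
    exact (sq_eq_sq₀ hx'.le hy'.le).1 (by linarith)
  have himg : f '' Ioi 0 ⊆ Ioi |z| := by
    rintro _ ⟨ρ, hρ, rfl⟩
    have : 0 < ρ := hρ
    exact Real.lt_sqrt_of_sq_lt (by rw [sq_abs]; nlinarith)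
  refine le_trans (le_of_eq ?_) (lintegral_mono_set himg)
  rw [lintegral_image_eq_lintegral_abs_deriv_mul measurableSet_Ioi hd hinj]
  refine setLIntegral_congr_fun measurableSet_Ioi fun ρ hρ => ?_
  have hρ0 : 0 < ρ := hρ
  have hf0 : 0 < f ρ := Real.sqrt_pos.2 (hpos ρ hρ)
  have hf2 : f ρ ^ 2 - z ^ 2 = ρ ^ 2 := by
    simp only [hf]; rw [Real.sq_sqrt (hpos ρ hρ).le]; ring
  simp only [hf2]
  rw [← mul_assoc, ← ENNReal.ofReal_mul (abs_nonneg _), abs_of_pos (by positivity)]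
  congr 2
  rw [← mul_assoc, div_mul_cancel₀ _ hf0.ne', ← Real.rpow_natCast ρ 2, ← Real.rpow_mul hρ0.le,
    ← Real.rpow_natCast, Nat.cast_sub hn]
  conv_rhs => rw [← Real.rpow_one ρ]
  rw [← Real.rpow_mul hρ0.le, ← Real.rpow_add hρ0]
  congr 1
  push_cast
  ring

/-- The substitution b² = s² - 2sz + a², with Jacobian b/s. The range of b is that of the third side
of a triangle with sides s and a. -/
theorem lintegral_slice_change_le (H : ℝ → ℝ → ℝ≥0∞) {a s : ℝ} (ha : 0 < a) (hs : 0 < s) :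
    ∫⁻ z in Ioo (-a) a, H z √(s ^ 2 - 2 * s * z + a ^ 2) ≤
      ∫⁻ b in Ioo |s - a| (s + a),
        ENNReal.ofReal (b / s) * H ((s ^ 2 + a ^ 2 - b ^ 2) / (2 * s)) b := by
  set f : ℝ → ℝ := fun z => √(s ^ 2 - 2 * s * z + a ^ 2) with hf
  have hpos : ∀ z ∈ Ioo (-a) a, |s - a| ^ 2 < s ^ 2 - 2 * s * z + a ^ 2 := fun z hz => by
    rw [sq_abs]; nlinarith [hz.2]
  have hpos' : ∀ z ∈ Ioo (-a) a, 0 < s ^ 2 - 2 * s * z + a ^ 2 := fun z hz =>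
    (sq_nonneg _).trans_lt (hpos z hz)
  have hd : ∀ z ∈ Ioo (-a) a, HasDerivWithinAt f (-s / f z) (Ioo (-a) a) z := by
    intro z hz
    have h := ((((hasDerivAt_id z).const_mul (2 * s)).const_sub (s ^ 2)).add_const
      (a ^ 2)).sqrt (hpos' z hz).ne'
    refine (h.congr_deriv ?_).hasDerivWithinAt
    have : 0 < √(s ^ 2 - 2 * s * z + a ^ 2) := Real.sqrt_pos.2 (hpos' z hz)
    simp only [id, hf]
    field_simp
  have hinj : InjOn f (Ioo (-a) a) := by
    intro x hx y hy hxy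
    have h := congrArg (· ^ 2) hxy
    simp only [hf] at h
    rw [Real.sq_sqrt (hpos' x hx).le, Real.sq_sqrt (hpos' y hy).le] at h
    exact mul_left_cancel₀ hs.ne' (by linarith)
  have himg : f '' Ioo (-a) a ⊆ Ioo |s - a| (s + a) := by
    rintro _ ⟨z, hz, rfl⟩
    refine ⟨Real.lt_sqrt_of_sq_lt (hpos z hz), ?_⟩
    rw [hf, Real.sqrt_lt' (by positivity)]
    nlinarith [hz.1]
  refine le_trans (le_of_eq ?_) (lintegral_mono_set himg)
  rw [lintegral_image_eq_lintegral_abs_deriv_mul measurableSet_Ioo hd hinj]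
  refine setLIntegral_congr_fun measurableSet_Ioo fun z hz => ?_
  have hf0 : 0 < f z := Real.sqrt_pos.2 (hpos' z hz)
  have hf2 : (s ^ 2 + a ^ 2 - f z ^ 2) / (2 * s) = z := by
    simp only [hf]; rw [Real.sq_sqrt (hpos' z hz).le]; field_simp; ring
  simp only [hf2]
  rw [← mul_assoc, ← ENNReal.ofReal_mul (abs_nonneg _), neg_div, abs_neg,
    abs_of_pos (by positivity), div_mul_div_cancel₀ hf0.ne', div_self hs.ne', ENNReal.ofReal_one,
    one_mul]

/-- The density of the radial convolution in bipolar coordinates. -/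
noncomputable def bipolarKernel (n : ℕ) (s a b : ℝ) : ℝ≥0∞ :=
  if 0 < a ∧ |s - a| < b ∧ b < s + a then
    ENNReal.ofReal (a * (b / s) *
      (a ^ 2 - ((s ^ 2 + a ^ 2 - b ^ 2) / (2 * s)) ^ 2) ^ (((n : ℝ) - 2) / 2)) else 0

/-- In cylindrical coordinates ρ is exchanged for a at fixed z; then, after Tonelli, z is exchanged
for b at fixed a. -/
theorem radConv_le_bipolar {n : ℕ} (hn : 1 ≤ n) {F : ℝ → ℝ≥0∞} (hF : Measurable F) {s : ℝ}
    (hs : 0 < s) :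
    radConv n F s ≤ (volume : Measure (EuclideanSpace ℝ (Fin n))).toSphere univ *
      ∫⁻ a, ∫⁻ b, bipolarKernel n s a b * (F a * F b) := by
  rw [radConv_eq hn hF]
  refine mul_le_mul' le_rfl ?_
  set X : ℝ → ℝ → ℝ≥0∞ := fun z a => if |z| < a then
    ENNReal.ofReal (a * (a ^ 2 - z ^ 2) ^ (((n : ℝ) - 2) / 2)) *
      (F a * F √(s ^ 2 - 2 * s * z + a ^ 2)) else 0 with hX
  have hXm : Measurable (Function.uncurry X) := by
    have h : Measurable fun q : ℝ × ℝ => if |q.1| < q.2 then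
      ENNReal.ofReal (q.2 * (q.2 ^ 2 - q.1 ^ 2) ^ (((n : ℝ) - 2) / 2)) *
        (F q.2 * F √(s ^ 2 - 2 * s * q.1 + q.2 ^ 2)) else 0 := by
      refine Measurable.ite (measurableSet_lt (by fun_prop) measurable_snd) ?_ measurable_const
      exact Measurable.mul (by fun_prop) ((hF.comp measurable_snd).mul (hF.comp (by fun_prop)))
    exact h
  calc ∫⁻ z : ℝ, ∫⁻ ρ in Ioi (0 : ℝ), ENNReal.ofReal (ρ ^ (n - 1)) *
        (F √(z ^ 2 + ρ ^ 2) * F √((s - z) ^ 2 + ρ ^ 2))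
      ≤ ∫⁻ z, ∫⁻ a, X z a := by
        refine lintegral_mono fun z => ?_
        have h := lintegral_polar_change_le hn
          (fun a => F a * F √(s ^ 2 - 2 * s * z + a ^ 2)) z
        refine le_trans (le_of_eq ?_) (h.trans (le_of_eq ?_))
        · refine setLIntegral_congr_fun measurableSet_Ioi fun ρ hρ => ?_
          rw [Real.sq_sqrt (by positivity)]
          ring_nf
        · rw [← lintegral_indicator measurableSet_Ioi]
          rfl
    _ = ∫⁻ a, ∫⁻ z, X z a := lintegral_lintegral_swap hXm.aemeasurable
    _ ≤ _ := by
        refine lintegral_mono fun a => ?_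
        rcases le_or_gt a 0 with ha | ha
        · have : ∀ z, X z a = 0 := fun z => if_neg (by linarith [abs_nonneg z])
          simp [this]
        · calc ∫⁻ z, X z a = ∫⁻ z in Ioo (-a) a,
                ENNReal.ofReal (a * (a ^ 2 - z ^ 2) ^ (((n : ℝ) - 2) / 2)) *
                  (F a * F √(s ^ 2 - 2 * s * z + a ^ 2)) := by
                rw [← lintegral_indicator measurableSet_Ioo]
                refine lintegral_congr fun z => ?_
                simp only [hX, indicator, mem_Ioo, abs_lt]
            _ ≤ _ := lintegral_slice_change_le (fun z b =>
                ENNReal.ofReal (a * (a ^ 2 - z ^ 2) ^ (((n : ℝ) - 2) / 2)) * (F a * F b)) ha hs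
            _ = _ := by
                rw [← lintegral_indicator measurableSet_Ioo]
                refine lintegral_congr fun b => ?_
                by_cases hb : b ∈ Ioo |s - a| (s + a)
                · have hb0 : 0 < b := (abs_nonneg _).trans_lt hb.1
                  rw [indicator_of_mem hb, bipolarKernel, if_pos ⟨ha, hb⟩, ← mul_assoc,
                    ← ENNReal.ofReal_mul (by positivity)]
                  congr 2
                  ring
                · rw [indicator_of_notMem hb, bipolarKernel, if_neg fun h => hb h.2, zero_mul]

end NSRenorm

/-! ### Size of the bipolar kernel and the shell estimate. -/

namespace NSRenorm

/-- Heron's formula for the squared height of the triangle over the side s. -/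
theorem triangle_height_eq {s : ℝ} (hs : s ≠ 0) (a b : ℝ) :
    a ^ 2 - ((s ^ 2 + a ^ 2 - b ^ 2) / (2 * s)) ^ 2 =
      (a + b + s) * (b + s - a) * (a ^ 2 - (b - s) ^ 2) / (4 * s ^ 2) := by
  field_simp
  ring

/-- The height over s does not depend on which of the other two sides it is computed from. -/
theorem bipolarKernel_comm (n : ℕ) {s : ℝ} (hs : 0 < s) {a b : ℝ} (ha : 0 < a) (hb : 0 < b) :
    bipolarKernel n s a b = bipolarKernel n s b a := by
  have h1 : a ^ 2 - ((s ^ 2 + a ^ 2 - b ^ 2) / (2 * s)) ^ 2 =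
      b ^ 2 - ((s ^ 2 + b ^ 2 - a ^ 2) / (2 * s)) ^ 2 := by
    field_simp
    ring
  have h2 : a * (b / s) = b * (a / s) := by ring
  have h3 : (0 < a ∧ |s - a| < b ∧ b < s + a) ↔ (0 < b ∧ |s - b| < a ∧ a < s + b) := by
    simp only [abs_lt]
    constructor <;> rintro ⟨_, ⟨_, _⟩, _⟩ <;> refine ⟨by linarith, ⟨by linarith, by linarith⟩,
      by linarith⟩
  simp only [bipolarKernel, h1, h2, h3]

/-- The singularity exponent of the bipolar kernel in dimension `n + 1`. -/
noncomputable def singExp (n : ℕ) : ℝ := if n = 1 then 1 / 2 else 0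

/-- The squared height D enters with exponent (n - 2)/2. This is negative only for n = 1, where a
lower bound for D produces the singularity (a - |b-s|)^{-1/2}. For n ≥ 2 the trivial bound D ≤ a²
suffices. -/
theorem bipolarKernel_le_of_le {n : ℕ} (hn : 1 ≤ n) {s : ℝ} (hs : 1 ≤ s) {a b : ℝ}
    (hab : a ≤ b) :
    bipolarKernel n s a b ≤ 2 * triKernel (singExp n) (n - 1) 1 s a b := by
  unfold bipolarKernel
  split_ifs with h
  swap
  · exact zero_le
  obtain ⟨ha, hb1, hb2⟩ := h
  have hb1' := abs_lt.1 hb1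
  have hb : 0 < b := ha.trans_le hab
  have hs0 : 0 < s := by linarith
  have hbs : |b - s| < a := abs_lt.2 ⟨by linarith, by linarith⟩
  have hd : 0 < a - |b - s| := by linarith
  rw [triKernel, if_pos ⟨ha, hab, hbs⟩, ← ENNReal.ofReal_ofNat 2, ← ENNReal.ofReal_mul (by simp)]
  apply ENNReal.ofReal_le_ofReal
  set D := a ^ 2 - ((s ^ 2 + a ^ 2 - b ^ 2) / (2 * s)) ^ 2 with hD
  have hDle : D ≤ a ^ 2 := by
    have := sq_nonneg ((s ^ 2 + a ^ 2 - b ^ 2) / (2 * s)); linarith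
  -- In Heron's product, a ≤ b gives a + b + s ≥ b and b + s - a ≥ s, while a² - (b-s)² ≥ a (a -
  -- |b-s|).
  have hDge : a * b * (a - |b - s|) / (4 * s) ≤ D := by
    rw [hD, triangle_height_eq hs0.ne', div_le_div_iff₀ (by positivity) (by positivity)]
    have h1 : a * (a - |b - s|) ≤ a ^ 2 - (b - s) ^ 2 := by
      rw [← sq_abs (b - s)]; nlinarith [abs_nonneg (b - s)]
    have h2 : b * s ≤ (a + b + s) * (b + s - a) := by nlinarith
    have h3 : (b * s) * (a * (a - |b - s|)) ≤
        (a + b + s) * (b + s - a) * (a ^ 2 - (b - s) ^ 2) := by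
      apply mul_le_mul h2 h1 (by positivity)
      exact mul_nonneg (by linarith) (by linarith)
    have := mul_le_mul_of_nonneg_right h3 (show 0 ≤ 4 * s by positivity)
    nlinarith
  have hD0 : 0 < D := lt_of_lt_of_le (by positivity) hDge
  rcases eq_or_ne n 1 with rfl | hn1
  · rw [singExp, if_pos rfl]
    have e1 : (((1 : ℕ) : ℝ) - 2) / 2 = -(1 / 2) := by norm_num
    have e2 : ((1 : ℕ) : ℝ) - 1 + 1 / 2 = 1 / 2 := by norm_num
    have e3 : (1 : ℝ) - 1 / 2 = 1 / 2 := by norm_num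
    rw [e1, e2, e3]
    have h1 : D ^ (-(1 / 2 : ℝ)) ≤ (a * b * (a - |b - s|) / (4 * s)) ^ (-(1 / 2 : ℝ)) :=
      Real.rpow_le_rpow_of_nonpos (by positivity) hDge (by norm_num)
    have h2 : (a * b * (a - |b - s|) / (4 * s)) ^ (-(1 / 2 : ℝ)) =
        2 * (s ^ (1 / 2 : ℝ) * (a ^ (-(1 / 2 : ℝ)) * b ^ (-(1 / 2 : ℝ)) *
          (a - |b - s|) ^ (-(1 / 2 : ℝ)))) := by
      rw [Real.div_rpow (by positivity) (by positivity), Real.mul_rpow (by positivity) hd.le,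
        Real.mul_rpow ha.le hb.le, Real.mul_rpow (by norm_num) hs0.le, Real.rpow_neg hs0.le,
        Real.rpow_neg (by norm_num : (0 : ℝ) ≤ 4), ← Real.sqrt_eq_rpow 4,
        show √(4 : ℝ) = 2 by rw [show (4 : ℝ) = 2 ^ 2 by norm_num]; exact Real.sqrt_sq (by norm_num)]
      have : (0 : ℝ) < s ^ (1 / 2 : ℝ) := by positivity
      field_simp
    have h3 : ∀ x : ℝ, 0 < x → x * x ^ (-(1 / 2 : ℝ)) = x ^ (1 / 2 : ℝ) := fun x hx => by
      conv_lhs => rw [← Real.rpow_one x]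
      rw [← Real.rpow_mul hx.le, ← Real.rpow_add hx]; norm_num
    have h4 : s ^ (1 / 2 : ℝ) / s ≤ 1 := by
      rw [div_le_one hs0]
      calc s ^ (1 / 2 : ℝ) ≤ s ^ (1 : ℝ) := Real.rpow_le_rpow_of_exponent_le hs (by norm_num)
        _ = s := Real.rpow_one s
    calc a * (b / s) * D ^ (-(1 / 2 : ℝ))
        ≤ a * (b / s) * (2 * (s ^ (1 / 2 : ℝ) * (a ^ (-(1 / 2 : ℝ)) * b ^ (-(1 / 2 : ℝ)) *
          (a - |b - s|) ^ (-(1 / 2 : ℝ))))) := by rw [← h2]; gcongr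
      _ = (s ^ (1 / 2 : ℝ) / s) * (2 * ((a * a ^ (-(1 / 2 : ℝ))) * (b * b ^ (-(1 / 2 : ℝ))) *
          (a - |b - s|) ^ (-(1 / 2 : ℝ)))) := by ring
      _ ≤ 1 * (2 * ((a * a ^ (-(1 / 2 : ℝ))) * (b * b ^ (-(1 / 2 : ℝ))) *
          (a - |b - s|) ^ (-(1 / 2 : ℝ)))) := by gcongr
      _ = _ := by rw [h3 a ha, h3 b hb, one_mul]
  · have hn2 : (2 : ℝ) ≤ n := by
      have : 2 ≤ n := by omega
      exact_mod_cast this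
    rw [singExp, if_neg hn1]
    simp only [add_zero, sub_zero, neg_zero, Real.rpow_zero, mul_one, Real.rpow_one]
    have h1 : D ^ (((n : ℝ) - 2) / 2) ≤ a ^ ((n : ℝ) - 2) := by
      calc D ^ (((n : ℝ) - 2) / 2) ≤ (a ^ 2) ^ (((n : ℝ) - 2) / 2) :=
            Real.rpow_le_rpow hD0.le hDle (by linarith)
        _ = a ^ ((n : ℝ) - 2) := by
            rw [← Real.rpow_natCast, ← Real.rpow_mul ha.le]; congr 1; push_cast; ring
    have h2 : b / s ≤ b := div_le_self hb.le hs
    have h3 : a * a ^ ((n : ℝ) - 2) = a ^ ((n : ℝ) - 1) := by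
      conv_lhs => rw [← Real.rpow_one a]
      rw [← Real.rpow_mul ha.le, ← Real.rpow_add ha]; congr 1; ring
    calc a * (b / s) * D ^ (((n : ℝ) - 2) / 2) ≤ a * b * a ^ ((n : ℝ) - 2) := by gcongr
      _ = a ^ ((n : ℝ) - 1) * b := by rw [← h3]; ring
      _ ≤ _ := by
          have : 0 ≤ a ^ ((n : ℝ) - 1) * b := by positivity
          linarith

theorem bipolarKernel_le {n : ℕ} (hn : 1 ≤ n) {s : ℝ} (hs : 1 ≤ s) (a b : ℝ) :
    bipolarKernel n s a b ≤ 2 * triKernel (singExp n) (n - 1) 1 s a b +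
      2 * triKernel (singExp n) (n - 1) 1 s b a := by
  rcases le_total a b with h | h
  · exact (bipolarKernel_le_of_le hn hs h).trans le_self_add
  · by_cases hab : 0 < a ∧ |s - a| < b ∧ b < s + a
    · rw [bipolarKernel_comm n (by linarith) hab.1 ((abs_nonneg _).trans_lt hab.2.1)]
      exact (bipolarKernel_le_of_le hn hs h).trans le_add_self
    · rw [bipolarKernel, if_neg hab]
      exact zero_le

/-- Moving the weights a^m and b^m onto F lowers both e and f by m. From e = n - 1 and f = 1 this
yields the decay exponent σ = 2m - n. -/
theorem triKernel_mul_eq (l e f m s a b : ℝ) (F : ℝ → ℝ≥0∞) :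
    triKernel l e f s a b * (F a * F b) = triKernel l (e - m) (f - m) s a b *
      (ENNReal.ofReal (a ^ m) * F a * (ENNReal.ofReal (b ^ m) * F b)) := by
  unfold triKernel
  split_ifs with h
  · obtain ⟨ha, hab, hbs⟩ := h
    have hb : 0 < b := ha.trans_le hab
    have hd : 0 < a - |b - s| := by linarith
    have e1 : a ^ (e + l) * b ^ (f - l) * (a - |b - s|) ^ (-l) =
        a ^ (e - m + l) * b ^ (f - m - l) * (a - |b - s|) ^ (-l) * (a ^ m * b ^ m) := by
      rw [show e + l = (e - m + l) + m by ring, show f - l = (f - m - l) + m by ring,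
        Real.rpow_add ha, Real.rpow_add hb]
      ring
    rw [e1, ENNReal.ofReal_mul (by positivity), ENNReal.ofReal_mul (show 0 ≤ a ^ m by positivity)]
    ring
  · simp

/-- Weighted bound for the convolution square of a radial function on the shell `1 ≤ |x| ≤ L`. -/
theorem exists_lintegral_radConv_rpow_le {n : ℕ} (hn : 1 ≤ n) {p r m : ℝ} (hp : 1 < p)
    (hpr : p ≤ r) (hl : singExp n < 2 + 1 / r - 2 / p)
    (he : 0 < n - 1 - m + (2 + 1 / r - 2 / p)) (hσ0 : n ≤ 2 * m) (hσ : 1 - 2 / p < 2 * m - n)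
    (L : ℝ) :
    ∃ C : ℝ≥0∞, C ≠ ⊤ ∧ ∀ F : ℝ → ℝ≥0∞, Measurable F →
      ∫⁻ s in Icc 1 L, radConv n F s ^ r ≤
        C * (∫⁻ a in Ioi (0 : ℝ), (ENNReal.ofReal (a ^ m) * F a) ^ p) ^ (2 * r / p) := by
  have hr0 : 0 < r := by linarith
  have hp0 : 0 < p := by linarith
  have hl1 : singExp n < 1 := by unfold singExp; split_ifs <;> norm_num
  obtain ⟨C, hC, h⟩ := exists_lintegral_triKernel_rpow_le (f := 1 - m) (σ := 2 * m - n) hp hpr hl1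
    hl he (by ring) (by linarith) hσ L
  set c := (volume : Measure (EuclideanSpace ℝ (Fin n))).toSphere univ with hc
  have hct : c ≠ ⊤ := measure_ne_top _ _
  refine ⟨(c * 4) ^ r * C, ENNReal.mul_ne_top (ENNReal.rpow_ne_top_of_nonneg hr0.le
    (ENNReal.mul_ne_top hct (by simp))) hC, fun F hF => ?_⟩
  set w : ℝ → ℝ≥0∞ := (Ioi 0).indicator fun a => ENNReal.ofReal (a ^ m) * F a with hw
  have hwm : Measurable w := Measurable.indicator (Measurable.mul (by fun_prop) hF)
    measurableSet_Ioi
  set k := triKernel (singExp n) (n - 1) 1 with hk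
  have hkw : ∀ s a b, k s a b * (F a * F b) =
      triKernel (singExp n) (n - 1 - m) (1 - m) s a b * (w a * w b) := by
    intro s a b
    rw [hk, triKernel_mul_eq _ _ _ m]
    by_cases hab : 0 < a ∧ a ≤ b
    · rw [hw, indicator_of_mem (show a ∈ Ioi 0 from hab.1),
        indicator_of_mem (show b ∈ Ioi 0 from hab.1.trans_le hab.2)]
    · rw [triKernel, if_neg fun h => hab ⟨h.1, h.2.1⟩]; simp
  have hkm : ∀ s, Measurable (Function.uncurry fun a b => k s a b * (F a * F b)) := fun s =>
    (measurable_triKernel _ _ _ s).mul ((hF.comp measurable_fst).mul (hF.comp measurable_snd))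
  have key : ∀ s ∈ Icc 1 L, radConv n F s ≤ c * 4 * ∫⁻ a, ∫⁻ b,
      triKernel (singExp n) (n - 1 - m) (1 - m) s a b * (w a * w b) := by
    intro s hs
    refine (radConv_le_bipolar hn hF (by linarith [hs.1])).trans ?_
    rw [mul_assoc]
    refine mul_le_mul' le_rfl ?_
    simp only [← hkw]
    have hk2 : Measurable (Function.uncurry fun a b => 2 * (k s a b * (F a * F b))) :=
      (hkm s).const_mul 2
    calc ∫⁻ a, ∫⁻ b, bipolarKernel n s a b * (F a * F b)
        ≤ ∫⁻ a, ∫⁻ b, (2 * (k s a b * (F a * F b)) + 2 * (k s b a * (F b * F a))) := by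
          refine lintegral_mono fun a => lintegral_mono fun b => ?_
          refine (mul_le_mul_left (bipolarKernel_le hn hs.1 a b) _).trans (le_of_eq ?_)
          ring
      _ = (∫⁻ a, ∫⁻ b, 2 * (k s a b * (F a * F b))) +
          ∫⁻ a, ∫⁻ b, 2 * (k s b a * (F b * F a)) := lintegral_lintegral_add_left hk2 _
      _ = (∫⁻ a, ∫⁻ b, 2 * (k s a b * (F a * F b))) +
          ∫⁻ a, ∫⁻ b, 2 * (k s a b * (F a * F b)) := by
          congr 1
          exact (lintegral_lintegral_swap hk2.aemeasurable).symm
      _ = 4 * ∫⁻ a, ∫⁻ b, k s a b * (F a * F b) := by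
          simp only [lintegral_const_mul' _ _ (ENNReal.ofNat_ne_top (n := 2))]
          ring
  calc ∫⁻ s in Icc 1 L, radConv n F s ^ r
      ≤ ∫⁻ s in Icc 1 L, (c * 4) ^ r * (∫⁻ a, ∫⁻ b,
          triKernel (singExp n) (n - 1 - m) (1 - m) s a b * (w a * w b)) ^ r := by
        refine setLIntegral_mono' measurableSet_Icc fun s hs => ?_
        rw [← ENNReal.mul_rpow_of_nonneg _ _ hr0.le]
        gcongr
        exact key s hs
    _ = (c * 4) ^ r * ∫⁻ s in Icc 1 L, (∫⁻ a, ∫⁻ b,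
          triKernel (singExp n) (n - 1 - m) (1 - m) s a b * (w a * w b)) ^ r :=
        lintegral_const_mul' _ _ (ENNReal.rpow_ne_top_of_nonneg hr0.le
          (ENNReal.mul_ne_top hct (by simp)))
    _ ≤ (c * 4) ^ r * (C * (∫⁻ a, w a ^ p) ^ (2 * r / p)) := by gcongr; exact h w hwm
    _ = _ := by
        rw [← lintegral_indicator measurableSet_Ioi, mul_assoc]
        congr 5
        funext a
        by_cases ha : a ∈ Ioi (0 : ℝ)
        · simp only [hw, indicator_of_mem ha]
        · simp only [hw, indicator_of_notMem ha, ENNReal.zero_rpow_of_pos hp0]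

end NSRenorm

/-! ### Scaling and the integral in time. -/

namespace NSRenorm

theorem single_zero_mul {n : ℕ} (R s : ℝ) :
    (EuclideanSpace.single 0 (R * s) : EuclideanSpace ℝ (Fin (n + 1))) =
      R • EuclideanSpace.single 0 s := by
  ext i
  simp

theorem lintegral_comp_const_smul {E : Type*} [NormedAddCommGroup E] [NormedSpace ℝ E]
    [MeasurableSpace E] [BorelSpace E] [FiniteDimensional ℝ E] (μ : Measure E)
    [μ.IsAddHaarMeasure] {g : E → ℝ≥0∞} (hg : Measurable g) {R : ℝ} (hR : 0 < R) :
    ∫⁻ x, g (R • x) ∂μ = ENNReal.ofReal (R ^ (-(Module.finrank ℝ E : ℝ))) * ∫⁻ x, g x ∂μ := by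
  rw [← lintegral_map hg (measurable_const_smul R), Measure.map_addHaar_smul μ hR.ne',
    lintegral_smul_measure, abs_of_pos (by positivity), smul_eq_mul, Real.rpow_neg hR.le,
    Real.rpow_natCast]

theorem radConv_comp_mul (n : ℕ) {F : ℝ → ℝ≥0∞} (hF : Measurable F) {R : ℝ} (hR : 0 < R) (s : ℝ) :
    radConv n (fun a => F (R * a)) s =
      ENNReal.ofReal (R ^ (-((n : ℝ) + 1))) * radConv n F (R * s) := by
  have hm : Measurable fun y : EuclideanSpace ℝ (Fin (n + 1)) =>
      F ‖y‖ * F ‖EuclideanSpace.single 0 (R * s) - y‖ :=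
    (hF.comp measurable_norm).mul (hF.comp (by fun_prop))
  have h := lintegral_comp_const_smul volume hm hR
  rw [finrank_euclideanSpace_fin] at h
  push_cast at h
  rw [radConv, radConv, ← h]
  refine lintegral_congr fun y => ?_
  have e1 : EuclideanSpace.single 0 (R * s) - R • y =
      R • ((EuclideanSpace.single 0 s : EuclideanSpace ℝ (Fin (n + 1))) - y) := by
    rw [smul_sub, single_zero_mul]
  rw [e1, norm_smul, norm_smul, Real.norm_of_nonneg hR.le]

theorem lintegral_weight_comp_mul {F : ℝ → ℝ≥0∞} (hF : Measurable F) {R m p : ℝ} (hR : 0 < R)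
    (hp : 0 < p) :
    ∫⁻ a in Ioi (0 : ℝ), (ENNReal.ofReal (a ^ m) * F (R * a)) ^ p =
      ENNReal.ofReal (R ^ (-(m * p + 1))) *
        ∫⁻ a in Ioi (0 : ℝ), (ENNReal.ofReal (a ^ m) * F a) ^ p := by
  set w : ℝ → ℝ≥0∞ := (Ioi 0).indicator fun a => (ENNReal.ofReal (a ^ m) * F a) ^ p with hw
  have hwm : Measurable w := Measurable.indicator
    ((Measurable.mul (by fun_prop) hF).pow_const p) measurableSet_Ioi
  have h := lintegral_comp_const_smul volume hwm hR
  rw [Module.finrank_self, hw, lintegral_indicator measurableSet_Ioi, ← hw] at h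
  have e1 : ∀ a, (Ioi (0 : ℝ)).indicator
      (fun a => (ENNReal.ofReal (a ^ m) * F (R * a)) ^ p) a =
      ENNReal.ofReal (R ^ (-(m * p))) * w (R • a) := by
    intro a
    by_cases ha : a ∈ Ioi (0 : ℝ)
    · have ha' : 0 < a := ha
      rw [hw, indicator_of_mem ha, indicator_of_mem (show R • a ∈ Ioi (0 : ℝ) from mul_pos hR ha'),
        smul_eq_mul, ENNReal.mul_rpow_of_nonneg _ _ hp.le, ENNReal.mul_rpow_of_nonneg _ _ hp.le,
        ENNReal.ofReal_rpow_of_nonneg (by positivity) hp.le,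
        ENNReal.ofReal_rpow_of_nonneg (by positivity) hp.le, ← mul_assoc,
        ← ENNReal.ofReal_mul (by positivity), Real.mul_rpow hR.le ha'.le,
        Real.mul_rpow (by positivity) (by positivity), ← Real.rpow_mul hR.le, ← mul_assoc,
        ← Real.rpow_add hR, neg_add_cancel, Real.rpow_zero, one_mul]
    · have : R • a ∉ Ioi (0 : ℝ) := by
        simp only [mem_Ioi, not_lt, smul_eq_mul] at ha ⊢
        exact mul_nonpos_of_nonneg_of_nonpos hR.le ha
      rw [hw, indicator_of_notMem ha, indicator_of_notMem this, mul_zero]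
  rw [← lintegral_indicator measurableSet_Ioi, lintegral_congr e1,
    lintegral_const_mul' _ _ ENNReal.ofReal_ne_top, h, ← mul_assoc,
    ← ENNReal.ofReal_mul (by positivity), ← Real.rpow_add hR]
  congr 3
  push_cast
  ring

/-- The shell estimate applied to the dilated profile F(ρ·). The factor ρ^{n+1} from the convolution
and the dilation factor of the weighted L^p integral give a power of ρ in which r cancels. -/
theorem exists_lintegral_radConv_mul_rpow_le {n : ℕ} (hn : 1 ≤ n) {p r m : ℝ} (hp : 1 < p)
    (hpr : p ≤ r) (hl : singExp n < 2 + 1 / r - 2 / p)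
    (he : 0 < n - 1 - m + (2 + 1 / r - 2 / p)) (hσ0 : n ≤ 2 * m) (hσ : 1 - 2 / p < 2 * m - n)
    (L : ℝ) {F : ℝ → ℝ≥0∞} (hF : Measurable F)
    (hFp : ∫⁻ a in Ioi (0 : ℝ), (ENNReal.ofReal (a ^ m) * F a) ^ p < ⊤) :
    ∃ K : ℝ≥0∞, K ≠ ⊤ ∧ ∀ ρ : ℝ, 0 < ρ →
      (∫⁻ s in Icc 1 L, radConv n F (ρ * s) ^ r) ^ (1 / r) ≤
        K * ENNReal.ofReal (ρ ^ (-(2 * m + 2 / p - (n + 1)))) := by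
  have hr0 : 0 < r := by linarith
  have hp0 : 0 < p := by linarith
  obtain ⟨C, hC, h⟩ := exists_lintegral_radConv_rpow_le hn hp hpr hl he hσ0 hσ L
  set N := ∫⁻ a in Ioi (0 : ℝ), (ENNReal.ofReal (a ^ m) * F a) ^ p with hN
  refine ⟨(C * N ^ (2 * r / p)) ^ (1 / r), ENNReal.rpow_ne_top_of_nonneg (by positivity)
    (ENNReal.mul_ne_top hC (ENNReal.rpow_ne_top_of_nonneg (by positivity) hFp.ne)),
    fun ρ hρ => ?_⟩
  have h1 := h (fun a => F (ρ * a)) (hF.comp (measurable_const_mul ρ))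
  simp only [radConv_comp_mul n hF hρ] at h1
  rw [lintegral_weight_comp_mul hF hρ hp0, ← hN] at h1
  have e1 : ∀ s, radConv n F (ρ * s) ^ r = ENNReal.ofReal (ρ ^ (((n : ℝ) + 1) * r)) *
      (ENNReal.ofReal (ρ ^ (-((n : ℝ) + 1))) * radConv n F (ρ * s)) ^ r := by
    intro s
    rw [ENNReal.mul_rpow_of_nonneg _ _ hr0.le, ENNReal.ofReal_rpow_of_nonneg (by positivity) hr0.le,
      ← mul_assoc, ← ENNReal.ofReal_mul (by positivity), ← Real.rpow_mul hρ.le, ← Real.rpow_add hρ,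
      neg_mul, add_neg_cancel, Real.rpow_zero, ENNReal.ofReal_one, one_mul]
  rw [lintegral_congr e1, lintegral_const_mul' _ _ ENNReal.ofReal_ne_top]
  calc _ ≤ (ENNReal.ofReal (ρ ^ (((n : ℝ) + 1) * r)) *
        (C * (ENNReal.ofReal (ρ ^ (-(m * p + 1))) * N) ^ (2 * r / p))) ^ (1 / r) := by gcongr
    _ = (ENNReal.ofReal (ρ ^ (-(2 * m + 2 / p - (n + 1)) * r)) *
        (C * N ^ (2 * r / p))) ^ (1 / r) := by
        rw [ENNReal.mul_rpow_of_nonneg _ N (by positivity),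
          ENNReal.ofReal_rpow_of_nonneg (by positivity) (by positivity), ← Real.rpow_mul hρ.le,
          show -(2 * m + 2 / p - (n + 1)) * r =
            ((n : ℝ) + 1) * r + -(m * p + 1) * (2 * r / p) by field_simp; ring, Real.rpow_add hρ,
          ENNReal.ofReal_mul (by positivity)]
        congr 1
        ring
    _ = _ := by
        rw [ENNReal.mul_rpow_of_nonneg _ _ (by positivity : 0 ≤ 1 / r),
          ENNReal.ofReal_rpow_of_nonneg (by positivity) (by positivity), ← Real.rpow_mul hρ.le,
          mul_assoc, mul_one_div_cancel hr0.ne', mul_one, mul_comm]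

/-- Smoothing of the semigroup in time. -/
theorem exists_lintegral_exp_le {γ β q : ℝ} (hγ : 0 < γ) (hβ : 0 < β) (hq : 0 < q) :
    ∃ C : ℝ, 0 ≤ C ∧ ∀ ρ : ℝ, 0 < ρ →
      ∫⁻ t in Icc 1 (1 / β), ENNReal.ofReal (Real.exp (ρ ^ γ * (1 - t ^ γ))) ^ q ≤
        ENNReal.ofReal (C * min 1 (ρ ^ (-γ))) := by
  set c := q * γ * β with hc
  have hc0 : 0 < c := by positivity
  refine ⟨max (1 / β) (1 / c), by positivity, fun ρ hρ => ?_⟩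
  have hexp : ∀ t ∈ Icc 1 (1 / β), ENNReal.ofReal (Real.exp (ρ ^ γ * (1 - t ^ γ))) ^ q ≤
      ENNReal.ofReal (Real.exp (-(c * ρ ^ γ) * (t - 1))) := by
    intro t ht
    have ht0 : 0 < t := by linarith [ht.1]
    rw [ENNReal.ofReal_rpow_of_pos (Real.exp_pos _), ← Real.exp_mul]
    apply ENNReal.ofReal_le_ofReal
    rw [Real.exp_le_exp]
    -- Together with log t ≥ 1 - 1/t ≥ β(t - 1) on [1, 1/β], this bounds t^γ - 1 below by γβ(t - 1)
    -- for every γ > 0, without assuming that t ↦ t^γ is convex.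
    have h1 : 1 + Real.log t * γ ≤ t ^ γ := by
      rw [Real.rpow_def_of_pos ht0]; linarith [Real.add_one_le_exp (Real.log t * γ)]
    have h2 : β * (t - 1) ≤ Real.log t := by
      refine le_trans ?_ (Real.one_sub_inv_le_log_of_pos ht0)
      have h3 : t * β ≤ 1 := by have := ht.2; rwa [le_div_iff₀ hβ] at this
      have h4 : (1 - t⁻¹) = t⁻¹ * (t - 1) := by field_simp
      rw [h4]
      have h5 : β ≤ t⁻¹ := by rw [← one_div, le_div_iff₀ ht0]; linarith
      exact mul_le_mul_of_nonneg_right h5 (by linarith [ht.1])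
    have h6 : γ * (β * (t - 1)) ≤ t ^ γ - 1 := by nlinarith
    have h7 : 0 ≤ ρ ^ γ * q := by positivity
    have := mul_le_mul_of_nonneg_left h6 h7
    rw [hc]
    nlinarith
  have hC := le_max_left (1 / β) (1 / c)
  have hC' := le_max_right (1 / β) (1 / c)
  -- For small ρ the integrand is at most 1 on an interval of length below 1/β; for large ρ the
  -- exponential is integrated over the whole half-line.
  rcases le_total 1 (ρ ^ (-γ)) with h | h
  · rw [min_eq_left h, mul_one]
    calc _ ≤ ∫⁻ t in Icc 1 (1 / β), (1 : ℝ≥0∞) := by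
          refine setLIntegral_mono' measurableSet_Icc fun t ht => (hexp t ht).trans ?_
          rw [← ENNReal.ofReal_one]
          apply ENNReal.ofReal_le_ofReal
          rw [Real.exp_le_one_iff]
          have : 0 ≤ c * ρ ^ γ := by positivity
          nlinarith [ht.1]
      _ = ENNReal.ofReal (1 / β - 1) := by rw [setLIntegral_one, Real.volume_Icc]
      _ ≤ _ := ENNReal.ofReal_le_ofReal (by linarith)
  · rw [min_eq_right h]
    have hk : 0 < c * ρ ^ γ := by positivity
    have hi : IntegrableOn (fun t : ℝ => Real.exp (-(c * ρ ^ γ) * (t - 1))) (Ioi 1) := by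
      have := (integrableOn_exp_mul_Ioi (neg_neg_of_pos hk) 1).const_mul (Real.exp (c * ρ ^ γ))
      refine IntegrableOn.congr_fun this (fun t _ => ?_) measurableSet_Ioi
      rw [← Real.exp_add]; ring_nf
    have hint : ∫ t in Ioi (1 : ℝ), Real.exp (-(c * ρ ^ γ) * (t - 1)) = 1 / (c * ρ ^ γ) := by
      have h1 := integral_exp_mul_Ioi (neg_neg_of_pos hk) 1
      have h2 : ∀ t : ℝ, Real.exp (-(c * ρ ^ γ) * (t - 1)) =
          Real.exp (c * ρ ^ γ) * Real.exp (-(c * ρ ^ γ) * t) := fun t => by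
        rw [← Real.exp_add]; ring_nf
      simp only [h2]
      rw [integral_const_mul, h1, mul_one, neg_div_neg_eq, ← mul_div_assoc, ← Real.exp_add]
      simp
    calc _ ≤ ∫⁻ t in Icc 1 (1 / β), ENNReal.ofReal (Real.exp (-(c * ρ ^ γ) * (t - 1))) :=
          setLIntegral_mono' measurableSet_Icc hexp
      _ ≤ ∫⁻ t in Ici 1, ENNReal.ofReal (Real.exp (-(c * ρ ^ γ) * (t - 1))) :=
          lintegral_mono_set Icc_subset_Ici_self
      _ = ENNReal.ofReal (1 / (c * ρ ^ γ)) := by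
          rw [← restrict_Ioi_eq_restrict_Ici, ← ofReal_integral_eq_lintegral_ofReal hi
            (Filter.Eventually.of_forall fun t => (Real.exp_pos _).le), hint]
      _ ≤ _ := by
          apply ENNReal.ofReal_le_ofReal
          rw [Real.rpow_neg hρ.le, one_div, mul_inv, ← one_div c]
          gcongr

/-- Hölder in t with exponents r/(r-1) and r: decay in ρ comes from the exponential factor, and the
convolution enters only through its L^r norm along the ray. -/
theorem exists_lintegral_exp_mul_radConv_le {n : ℕ} (hn : 1 ≤ n) {p r m γ β : ℝ} (hp : 1 < p)
    (hpr : p ≤ r) (hl : singExp n < 2 + 1 / r - 2 / p)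
    (he : 0 < n - 1 - m + (2 + 1 / r - 2 / p)) (hσ0 : n ≤ 2 * m) (hσ : 1 - 2 / p < 2 * m - n)
    (hγ : 0 < γ) (hβ : 0 < β) {F : ℝ → ℝ≥0∞} (hF : Measurable F)
    (hFp : ∫⁻ a in Ioi (0 : ℝ), (ENNReal.ofReal (a ^ m) * F a) ^ p < ⊤) :
    ∃ K : ℝ, 0 ≤ K ∧ ∀ ρ : ℝ, 0 < ρ →
      ∫⁻ t in Icc 1 (1 / β), ENNReal.ofReal (Real.exp (ρ ^ γ * (1 - t ^ γ))) *
          radConv n F (ρ * t) ≤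
        ENNReal.ofReal (K * (min 1 (ρ ^ (-γ)) ^ (1 - 1 / r) *
          ρ ^ (-(2 * m + 2 / p - (n + 1))))) := by
  have hr1 : 1 < r := by linarith
  have hr0 : 0 < r := by linarith
  have h1r : 0 < 1 - 1 / r := by rw [sub_pos, div_lt_one hr0]; exact hr1
  obtain ⟨K, hK, hKρ⟩ := exists_lintegral_radConv_mul_rpow_le hn hp hpr hl he hσ0 hσ (1 / β) hF hFp
  obtain ⟨C, hC, hCρ⟩ := exists_lintegral_exp_le (q := 1 / (1 - 1 / r)) hγ hβ (by positivity)
  refine ⟨C ^ (1 - 1 / r) * K.toReal, by positivity, fun ρ hρ => ?_⟩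
  have hm1 : Measurable fun t : ℝ => ENNReal.ofReal (Real.exp (ρ ^ γ * (1 - t ^ γ))) := by fun_prop
  have hm2 : Measurable fun t : ℝ => radConv n F (ρ * t) := by
    have h : Measurable fun q : ℝ × EuclideanSpace ℝ (Fin (n + 1)) =>
        F ‖q.2‖ * F ‖EuclideanSpace.single 0 (ρ * q.1) - q.2‖ := by
      refine (hF.comp (by fun_prop)).mul (hF.comp ?_)
      have : Continuous fun t : ℝ => (EuclideanSpace.single 0 (ρ * t) :
          EuclideanSpace ℝ (Fin (n + 1))) := by
        have h2 : (fun t : ℝ => (EuclideanSpace.single 0 (ρ * t) :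
          EuclideanSpace ℝ (Fin (n + 1)))) = fun t : ℝ => (ρ * t) • EuclideanSpace.single 0 1 := by
          funext t
          rw [← single_zero_mul, mul_one]
        rw [h2]; fun_prop
      exact (((this.comp continuous_fst).sub continuous_snd).norm).measurable
    exact h.lintegral_prod_right'
  have h := ENNReal.lintegral_mul_norm_pow_le (μ := volume.restrict (Icc 1 (1 / β)))
    (hm1.pow_const (1 / (1 - 1 / r))).aemeasurable (hm2.pow_const r).aemeasurable
    (p := 1 - 1 / r) (q := 1 / r) h1r.le (by positivity) (by ring)
  have e1 : ∀ t, (ENNReal.ofReal (Real.exp (ρ ^ γ * (1 - t ^ γ))) ^ (1 / (1 - 1 / r))) ^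
      (1 - 1 / r) * (radConv n F (ρ * t) ^ r) ^ (1 / r) =
      ENNReal.ofReal (Real.exp (ρ ^ γ * (1 - t ^ γ))) * radConv n F (ρ * t) := by
    intro t
    rw [← ENNReal.rpow_mul, ← ENNReal.rpow_mul, one_div_mul_cancel h1r.ne',
      mul_one_div_cancel hr0.ne', ENNReal.rpow_one, ENNReal.rpow_one]
  rw [lintegral_congr e1] at h
  refine h.trans ?_
  have hmin : 0 ≤ min 1 (ρ ^ (-γ)) := le_min zero_le_one (by positivity)
  calc _ ≤ ENNReal.ofReal (C * min 1 (ρ ^ (-γ))) ^ (1 - 1 / r) *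
        (K * ENNReal.ofReal (ρ ^ (-(2 * m + 2 / p - (n + 1))))) := by
        gcongr
        · exact hCρ ρ hρ
        · exact hKρ ρ hρ
    _ = _ := by
        rw [ENNReal.ofReal_rpow_of_nonneg (by positivity) h1r.le, ← ENNReal.ofReal_toReal hK,
          ← ENNReal.ofReal_mul (by positivity), ← ENNReal.ofReal_mul (by positivity),
          Real.mul_rpow hC hmin, ENNReal.toReal_ofReal (by positivity)]
        congr 1
        ring

end NSRenorm

/-! ### Profiles of radial fields and integrability of radial powers. -/

namespace NSRenorm

/-- A radial a.e.-measurable function has a measurable profile. -/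
theorem exists_measurable_profile {E : Type*} [NormedAddCommGroup E] [NormedSpace ℝ E]
    [MeasurableSpace E] [BorelSpace E] [FiniteDimensional ℝ E] [Nontrivial E] (μ : Measure E)
    [μ.IsAddHaarMeasure] {h : E → ℝ≥0∞} (hm : AEMeasurable h μ)
    (hrad : ∀ x y, ‖x‖ = ‖y‖ → h x = h y) :
    ∃ φ : ℝ → ℝ≥0∞, Measurable φ ∧ ∀ᵐ x ∂μ, h x = φ ‖x‖ := by
  set e := homeomorphUnitSphereProd E with he
  have hmp := μ.measurePreserving_homeomorphUnitSphereProd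
  have hres : (μ.comap ((↑) : ({(0 : E)}ᶜ : Set E) → E)).map (↑) = μ := by
    rw [map_comap_subtype_coe (measurableSet_singleton _).compl, restrict_compl_singleton]
  have hemb : MeasurableEmbedding ((↑) : ({(0 : E)}ᶜ : Set E) → E) :=
    MeasurableEmbedding.subtype_coe (measurableSet_singleton _).compl
  have hiff : ∀ P : E → Prop, (∀ᵐ x ∂μ, P x) ↔
      ∀ᵐ x : ({(0 : E)}ᶜ : Set E) ∂(μ.comap (↑)), P (x : E) := fun P => by
    conv_lhs => rw [← hres]
    exact hemb.ae_map_iff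
  have h1 := (hiff _).1 hm.ae_eq_mk
  have h2 : ∀ᵐ q ∂(μ.toSphere.prod (Measure.volumeIoiPow (Module.finrank ℝ E - 1))),
      h (e.symm q) = hm.mk h (e.symm q) := by
    rw [← hmp.map_eq, (Homeomorph.measurableEmbedding e).ae_map_iff]
    filter_upwards [h1] with x hx
    rw [e.symm_apply_apply]
    exact hx
  -- By Fubini, along almost every ray the function agrees almost everywhere with its measurable
  -- representative. The profile is that representative on one such ray.
  have h3 := Measure.ae_ae_of_ae_prod h2
  have : (ae μ.toSphere).NeBot := ae_neBot.2 (Measure.toSphere_ne_zero μ)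
  obtain ⟨ω, hω⟩ := h3.exists
  refine ⟨fun a => hm.mk h (a • (ω : E)), hm.measurable_mk.comp (by fun_prop), ?_⟩
  rw [hiff]
  have h4 := (Measure.quasiMeasurePreserving_snd (μ := μ.toSphere)
    (ν := Measure.volumeIoiPow (Module.finrank ℝ E - 1))).ae hω
  have h5 := hmp.quasiMeasurePreserving.ae h4
  filter_upwards [h5] with x hx
  have hωn : ‖(ω : E)‖ = 1 := by simp
  have e1 : h x = h (‖(x : E)‖ • (ω : E)) := hrad _ _ (by simp [norm_smul])
  rw [e1]
  simpa [he] using hx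

theorem memLp_ofReal_iff {α E : Type*} [MeasurableSpace α] [NormedAddCommGroup E] {μ : Measure α}
    {p : ℝ} (hp : 0 < p) {f : α → E} (hf : AEStronglyMeasurable f μ) :
    MemLp f (ENNReal.ofReal p) μ ↔ ∫⁻ x, ‖f x‖ₑ ^ p ∂μ < ⊤ := by
  rw [MemLp, and_iff_right hf, eLpNorm_lt_top_iff_lintegral_rpow_enorm_lt_top (by simpa using hp)
    ENNReal.ofReal_ne_top, ENNReal.toReal_ofReal hp.le]

/-- The profile of the dominating radial field, with the exponential weight included. -/
theorem exists_profile_of_memWeightedLp {n : ℕ} {ν p : ℝ} (hp : 0 < p)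
    {g : EuclideanSpace ℝ (Fin (n + 1)) → EuclideanSpace ℂ (Fin (n + 1))}
    (hg : MemWeightedLp (uWeight ν) p g) (hrad : IsRadialField g) :
    ∃ F : ℝ → ℝ≥0∞, Measurable F ∧
      (∀ᵐ x, ‖g x‖ₑ = ENNReal.ofReal (Real.exp (-‖x‖)) * F ‖x‖) ∧
      ∫⁻ a in Ioi (0 : ℝ), (ENNReal.ofReal (a ^ (ν + n / p)) * F a) ^ p < ⊤ := by
  obtain ⟨φ, hφ, hφg⟩ := exists_measurable_profile volume (h := fun x => ‖g x‖ₑ) hg.1.enorm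
    (fun x y hxy => by simp only [hrad x y hxy])
  refine ⟨fun a => ENNReal.ofReal (Real.exp a) * φ a, Measurable.mul (by fun_prop) hφ, ?_, ?_⟩
  · filter_upwards [hφg] with x hx
    rw [hx, ← mul_assoc, ← ENNReal.ofReal_mul (Real.exp_pos _).le, ← Real.exp_add, neg_add_cancel,
      Real.exp_zero, ENNReal.ofReal_one, one_mul]
  · have h1 := (memLp_ofReal_iff hp hg.2.1).1 hg.2
    -- In polar coordinates the Jacobian a^n is absorbed into the p-th power, which turns the weight
    -- a^ν into a^{ν + n/p}.
    set f : ℝ → ℝ≥0∞ := fun a => (ENNReal.ofReal (Real.exp a * a ^ ν) * φ a) ^ p with hf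
    have hfm : Measurable f := (Measurable.mul (by fun_prop) hφ).pow_const p
    have h2 : ∫⁻ x, ‖uWeight ν x • g x‖ₑ ^ p =
        ∫⁻ x : EuclideanSpace ℝ (Fin (n + 1)), f ‖x‖ := by
      refine lintegral_congr_ae ?_
      filter_upwards [hφg] with x hx
      rw [enorm_smul, hx, hf, uWeight, Real.enorm_of_nonneg (by positivity)]
    rw [h2, lintegral_fun_norm_addHaar volume hfm, finrank_euclideanSpace_fin,
      Nat.add_sub_cancel] at h1
    have hc : (volume : Measure (EuclideanSpace ℝ (Fin (n + 1)))).toSphere univ ≠ 0 := by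
      rw [ne_eq, Measure.measure_univ_eq_zero]
      exact Measure.toSphere_ne_zero _
    refine lt_of_le_of_lt (le_of_eq ?_) (ENNReal.lt_top_of_mul_ne_top_right h1.ne hc)
    refine setLIntegral_congr_fun measurableSet_Ioi fun a ha => ?_
    have ha0 : 0 < a := ha
    simp only [hf]
    rw [← mul_assoc, ← ENNReal.ofReal_mul (by positivity), ENNReal.mul_rpow_of_nonneg _ _ hp.le,
      ENNReal.mul_rpow_of_nonneg _ _ hp.le, ENNReal.ofReal_rpow_of_nonneg (by positivity) hp.le,
      ENNReal.ofReal_rpow_of_nonneg (by positivity) hp.le, ← mul_assoc,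
      ← ENNReal.ofReal_mul (by positivity)]
    congr 2
    rw [Real.rpow_add ha0, show a ^ ν * a ^ ((n : ℝ) / p) * Real.exp a =
      (Real.exp a * a ^ ν) * a ^ ((n : ℝ) / p) by ring, Real.mul_rpow (by positivity)
      (by positivity), ← Real.rpow_mul ha0.le, div_mul_cancel₀ _ hp.ne', Real.rpow_natCast]
    ring

theorem memLp_radial_power {n : ℕ} {p x y γ : ℝ} (hp : 0 < p) (hy : 0 ≤ y)
    (h0 : 0 < n + 1 + p * x) (h1 : n + 1 + p * x < γ * p * y) :
    MemLp (fun η : EuclideanSpace ℝ (Fin (n + 1)) => min 1 (‖η‖ ^ (-γ)) ^ y * ‖η‖ ^ x)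
      (ENNReal.ofReal p) := by
  have hm : Measurable fun ρ : ℝ => min 1 (ρ ^ (-γ)) ^ y * ρ ^ x := by fun_prop
  have hm' : Measurable fun η : EuclideanSpace ℝ (Fin (n + 1)) =>
      min 1 (‖η‖ ^ (-γ)) ^ y * ‖η‖ ^ x := hm.comp measurable_norm
  rw [memLp_ofReal_iff hp hm'.aestronglyMeasurable]
  have h2 := lintegral_fun_norm_addHaar (volume : Measure (EuclideanSpace ℝ (Fin (n + 1))))
    (hm.enorm.pow_const p)
  rw [h2, finrank_euclideanSpace_fin, Nat.add_sub_cancel]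
  refine ENNReal.mul_lt_top (measure_lt_top _ _) ?_
  have hi0 : IntegrableOn (fun ρ : ℝ => ρ ^ ((n : ℝ) + p * x)) (Ioc 0 1) :=
    (intervalIntegral.intervalIntegrable_rpow' (a := 0) (b := 1) (by linarith)).1
  have hi1 : IntegrableOn (fun ρ : ℝ => ρ ^ ((n : ℝ) + p * x - γ * p * y)) (Ioi 1) :=
    integrableOn_Ioi_rpow_of_lt (by linarith) one_pos
  -- Used with c = 0 on (0, 1] and c = -γ beyond 1. The two hypotheses place the resulting exponents
  -- on the integrable sides of -1.
  have key : ∀ ρ : ℝ, 0 < ρ → ∀ c : ℝ, min 1 (ρ ^ (-γ)) ≤ ρ ^ c →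
      ENNReal.ofReal (ρ ^ n) * ‖min 1 (ρ ^ (-γ)) ^ y * ρ ^ x‖ₑ ^ p ≤
        ENNReal.ofReal (ρ ^ ((n : ℝ) + p * x + c * p * y)) := by
    intro ρ hρ c hc
    have hmin : 0 ≤ min 1 (ρ ^ (-γ)) := le_min zero_le_one (by positivity)
    rw [Real.enorm_of_nonneg (by positivity), ENNReal.ofReal_rpow_of_nonneg (by positivity) hp.le,
      ← ENNReal.ofReal_mul (by positivity)]
    apply ENNReal.ofReal_le_ofReal
    calc ρ ^ n * (min 1 (ρ ^ (-γ)) ^ y * ρ ^ x) ^ p ≤ ρ ^ n * ((ρ ^ c) ^ y * ρ ^ x) ^ p := by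
          gcongr
      _ = _ := by
          rw [← Real.rpow_mul hρ.le, ← Real.rpow_add hρ, ← Real.rpow_mul hρ.le,
            ← Real.rpow_natCast, ← Real.rpow_add hρ]
          congr 1; ring
  rw [← Ioc_union_Ioi_eq_Ioi zero_le_one, lintegral_union measurableSet_Ioi
    (Ioc_disjoint_Ioi le_rfl), ENNReal.add_lt_top]
  constructor
  · refine lt_of_le_of_lt (setLIntegral_mono' measurableSet_Ioc fun ρ hρ => ?_)
      hi0.lintegral_lt_top
    simpa using key ρ hρ.1 0 (by simp)
  · refine lt_of_le_of_lt (setLIntegral_mono' measurableSet_Ioi fun ρ hρ => ?_)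
      hi1.lintegral_lt_top
    have := key ρ (one_pos.trans hρ) (-γ) (min_le_right _ _)
    rwa [show (n : ℝ) + p * x + -γ * p * y = n + p * x - γ * p * y by ring] at this

end NSRenorm

/-! ### Measurability, convergence and pointwise bounds for the operator. -/

namespace NSRenorm

theorem norm_dotC_le {d : ℕ} (η : EuclideanSpace ℝ (Fin d)) (v : EuclideanSpace ℂ (Fin d)) :
    ‖dotC η v‖ ≤ ‖η‖ * ‖v‖ := by
  rw [EuclideanSpace.norm_eq, EuclideanSpace.norm_eq]
  calc ‖dotC η v‖ ≤ ∑ i, ‖η i‖ * ‖v i‖ := by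
        refine (norm_sum_le _ _).trans (le_of_eq (Finset.sum_congr rfl fun i _ => ?_))
        rw [norm_mul, Complex.norm_real]
    _ ≤ _ := Real.sum_mul_le_sqrt_mul_sqrt _ _ _

theorem norm_leray_le {d : ℕ} (η : EuclideanSpace ℝ (Fin d)) (v : EuclideanSpace ℂ (Fin d)) :
    ‖leray η v‖ ≤ 2 * ‖v‖ := by
  set η' : EuclideanSpace ℂ (Fin d) := WithLp.toLp 2 fun i => (η i : ℂ) with hη'
  have h1 : ‖η'‖ = ‖η‖ := by
    rw [EuclideanSpace.norm_eq, EuclideanSpace.norm_eq]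
    simp [hη']
  have h2 : leray η v = v - (dotC η v / (‖η‖ : ℂ) ^ 2) • η' := by
    ext i
    simp [leray, hη']
  rw [h2]
  refine (norm_sub_le _ _).trans ?_
  have h3 : ‖(dotC η v / (‖η‖ : ℂ) ^ 2) • η'‖ ≤ ‖v‖ := by
    rw [norm_smul, norm_div, norm_pow, Complex.norm_real, norm_norm, h1]
    rcases eq_or_ne ‖η‖ 0 with h0 | h0
    · simp [h0]
    · have : 0 < ‖η‖ := lt_of_le_of_ne (norm_nonneg _) h0.symm
      calc ‖dotC η v‖ / ‖η‖ ^ 2 * ‖η‖ ≤ ‖η‖ * ‖v‖ / ‖η‖ ^ 2 * ‖η‖ := by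
            gcongr; exact norm_dotC_le η v
        _ = ‖v‖ := by field_simp
  linarith

theorem norm_bilinearIntegrand_le {d : ℕ}
    (ϑ : EuclideanSpace ℝ (Fin d) → EuclideanSpace ℂ (Fin d)) (η : EuclideanSpace ℝ (Fin d))
    (t : ℝ) (x : EuclideanSpace ℝ (Fin d)) :
    ‖bilinearIntegrand ϑ η t x‖ ≤ 2 * ‖η‖ * (‖ϑ x‖ * ‖ϑ (t • η - x)‖) := by
  rw [bilinearIntegrand, norm_smul]
  calc _ ≤ (‖η‖ * ‖ϑ (t • η - x)‖) * (2 * ‖ϑ x‖) := by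
        gcongr
        · exact norm_dotC_le _ _
        · exact norm_leray_le _ _
    _ = _ := by ring

theorem measurable_bilinear {d : ℕ} {α : Type*} [MeasurableSpace α]
    {f : α → EuclideanSpace ℝ (Fin d)} {g h : α → EuclideanSpace ℂ (Fin d)} (hf : Measurable f)
    (hg : Measurable g) (hh : Measurable h) :
    Measurable fun a => dotC (f a) (g a) • leray (f a) (h a) := by
  have hdot : ∀ k : α → EuclideanSpace ℂ (Fin d), Measurable k →
      Measurable fun a => dotC (f a) (k a) := by
    intro k hk
    unfold dotC
    fun_prop
  have hl : Measurable fun a => leray (f a) (h a) := by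
    unfold leray
    have := hdot h hh
    fun_prop
  exact (hdot g hg).smul hl

theorem measurable_timeFactor {d : ℕ} (γ : ℝ) :
    Measurable (Function.uncurry (timeFactor (d := d) γ)) := by
  unfold timeFactor Function.uncurry
  fun_prop

theorem measurable_timeFactor_smul_bilinearIntegrand {d : ℕ}
    {ϑ : EuclideanSpace ℝ (Fin d) → EuclideanSpace ℂ (Fin d)} (hϑ : Measurable ϑ) (γ : ℝ) :
    Measurable fun q : (EuclideanSpace ℝ (Fin d) × ℝ) × EuclideanSpace ℝ (Fin d) =>
      timeFactor γ q.1.1 q.1.2 • bilinearIntegrand ϑ q.1.1 q.1.2 q.2 := by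
  have hb : Measurable fun q : (EuclideanSpace ℝ (Fin d) × ℝ) × EuclideanSpace ℝ (Fin d) =>
      bilinearIntegrand ϑ q.1.1 q.1.2 q.2 :=
    measurable_bilinear (by fun_prop) (hϑ.comp (by fun_prop)) (hϑ.comp measurable_snd)
  have ht : Measurable fun q : (EuclideanSpace ℝ (Fin d) × ℝ) × EuclideanSpace ℝ (Fin d) =>
      timeFactor γ q.1.1 q.1.2 := (measurable_timeFactor γ).comp measurable_fst
  exact ht.smul hb

/-- For each t the map x ↦ tη - x preserves null sets, hence so does (t, x) ↦ tη - x on the product.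
Replacing ϑ by a measurable representative then changes the integrand only on a null set. -/
theorem aestronglyMeasurable_bilinear {d : ℕ}
    {ϑ : EuclideanSpace ℝ (Fin d) → EuclideanSpace ℂ (Fin d)}
    (hϑ : AEStronglyMeasurable ϑ volume) (γ : ℝ) (η : EuclideanSpace ℝ (Fin d)) (τ : Measure ℝ)
    [SFinite τ] :
    AEStronglyMeasurable (fun q : ℝ × EuclideanSpace ℝ (Fin d) =>
      timeFactor γ η q.1 • bilinearIntegrand ϑ η q.1 q.2) (τ.prod volume) := by
  have hsub : Measurable fun q : ℝ × EuclideanSpace ℝ (Fin d) => q.1 • η - q.2 := by fun_prop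
  have hq := QuasiMeasurePreserving.prod_of_right (μ := τ) hsub
      (Filter.Eventually.of_forall fun t => quasiMeasurePreserving_sub_left volume (t • η))
  have hs := Measure.quasiMeasurePreserving_snd (μ := τ)
    (ν := (volume : Measure (EuclideanSpace ℝ (Fin d))))
  obtain ⟨ϑ', hϑ', heq⟩ := hϑ
  have h1 := hq.ae heq
  have h2 := hs.ae heq
  have hg : Measurable fun q : ℝ × EuclideanSpace ℝ (Fin d) => ((η, q.1), q.2) := by fun_prop
  have hm := (measurable_timeFactor_smul_bilinearIntegrand hϑ'.measurable γ).comp hg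
  refine hm.aestronglyMeasurable.congr ?_
  filter_upwards [h1, h2] with q hq1 hq2
  simp only [Function.comp_apply, bilinearIntegrand, hq1, hq2]

theorem stronglyMeasurable_renorm {d : ℕ}
    {ϑ : EuclideanSpace ℝ (Fin d) → EuclideanSpace ℂ (Fin d)} (hϑ : Measurable ϑ) (γ : ℝ) {β : ℝ}
    (hβ : 0 < β) (hβ1 : β < 1) : StronglyMeasurable (renorm γ β ϑ) := by
  have h1 : StronglyMeasurable fun q : EuclideanSpace ℝ (Fin d) × ℝ =>
      ∫ x, timeFactor γ q.1 q.2 • bilinearIntegrand ϑ q.1 q.2 x :=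
    (measurable_timeFactor_smul_bilinearIntegrand hϑ γ).stronglyMeasurable.integral_prod_right'
  have h2 : StronglyMeasurable fun η : EuclideanSpace ℝ (Fin d) =>
      ∫ t in Ioc 1 (1 / β), ∫ x, timeFactor γ η t • bilinearIntegrand ϑ η t x :=
    h1.integral_prod_right'
  have h3 : Measurable fun η : EuclideanSpace ℝ (Fin d) =>
      (β ^ cExp d γ * Real.exp (‖η‖ ^ γ * (1 - 1 / β ^ γ))) • ϑ ((1 / β) • η) := by
    have h4 : Measurable fun η : EuclideanSpace ℝ (Fin d) => ϑ ((1 / β) • η) :=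
      hϑ.comp (by fun_prop)
    have h5 : Measurable fun η : EuclideanSpace ℝ (Fin d) =>
      β ^ cExp d γ * Real.exp (‖η‖ ^ γ * (1 - 1 / β ^ γ)) := by fun_prop
    exact h5.smul h4
  have h5 : (1 : ℝ) ≤ 1 / β := by rw [le_div_iff₀ hβ]; linarith
  have h6 : renorm γ β ϑ = fun η =>
      (β ^ cExp d γ * Real.exp (‖η‖ ^ γ * (1 - 1 / β ^ γ))) • ϑ ((1 / β) • η) +
      (Complex.I * (γ : ℂ)) • ∫ t in Ioc 1 (1 / β),
        ∫ x, timeFactor γ η t • bilinearIntegrand ϑ η t x := by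
    funext η
    simp only [renorm, intervalIntegral.integral_of_le h5, integral_smul]
  rw [h6]
  exact h3.stronglyMeasurable.add (h2.const_smul (Complex.I * (γ : ℂ)))

theorem aestronglyMeasurable_renorm {d : ℕ}
    {ϑ : EuclideanSpace ℝ (Fin d) → EuclideanSpace ℂ (Fin d)}
    (hϑ : AEStronglyMeasurable ϑ volume) (γ : ℝ) {β : ℝ} (hβ : 0 < β) (hβ1 : β < 1) :
    AEStronglyMeasurable (renorm γ β ϑ) volume := by
  obtain ⟨ϑ', hϑ', heq⟩ := hϑ
  exact ⟨_, stronglyMeasurable_renorm hϑ'.measurable γ hβ hβ1, renorm_congr_ae hβ heq⟩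

/-- Pointwise bound for the nonlinear term. -/
theorem exists_lintegral_bilinear_le {n : ℕ} (hn : 1 ≤ n) {p r m γ β : ℝ} (hp : 1 < p)
    (hpr : p ≤ r) (hl : singExp n < 2 + 1 / r - 2 / p)
    (he : 0 < n - 1 - m + (2 + 1 / r - 2 / p)) (hσ0 : n ≤ 2 * m) (hσ : 1 - 2 / p < 2 * m - n)
    (hγ : 0 < γ) (hβ : 0 < β)
    {ϑ : EuclideanSpace ℝ (Fin (n + 1)) → EuclideanSpace ℂ (Fin (n + 1))} {F : ℝ → ℝ≥0∞}
    (hF : Measurable F) (hFp : ∫⁻ a in Ioi (0 : ℝ), (ENNReal.ofReal (a ^ m) * F a) ^ p < ⊤)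
    (hϑF : ∀ᵐ x, ‖ϑ x‖ₑ ≤ ENNReal.ofReal (Real.exp (-‖x‖)) * F ‖x‖) :
    ∃ K : ℝ, 0 ≤ K ∧ ∀ η : EuclideanSpace ℝ (Fin (n + 1)), η ≠ 0 →
      ∫⁻ t in Ioc 1 (1 / β), ∫⁻ x, ‖timeFactor γ η t • bilinearIntegrand ϑ η t x‖ₑ ≤
        ENNReal.ofReal (K * (‖η‖ * Real.exp (-‖η‖) * (min 1 (‖η‖ ^ (-γ)) ^ (1 - 1 / r) *
          ‖η‖ ^ (-(2 * m + 2 / p - (n + 1)))))) := by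
  obtain ⟨K, hK, hKρ⟩ := exists_lintegral_exp_mul_radConv_le hn hp hpr hl he hσ0 hσ hγ hβ hF hFp
  set c := cExp (n + 1) γ with hc
  set B : ℝ := 1 ^ (-c) + (1 / β) ^ (-c) with hB
  have hB0 : 0 ≤ B := by positivity
  refine ⟨2 * B * K, by positivity, fun η hη => ?_⟩
  have hη0 : 0 < ‖η‖ := norm_pos_iff.2 hη
  -- Here t ≥ 1 is essential: |η| ≤ |tη| ≤ |x| + |tη - x|.
  have hexp : ∀ t ∈ Ioc 1 (1 / β), ∀ x : EuclideanSpace ℝ (Fin (n + 1)),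
      Real.exp (-‖x‖) * Real.exp (-‖t • η - x‖) ≤ Real.exp (-‖η‖) := by
    intro t ht x
    rw [← Real.exp_add, Real.exp_le_exp]
    have h1 : ‖t • η‖ ≤ ‖x‖ + ‖t • η - x‖ := by
      have := norm_add_le x (t • η - x)
      rwa [add_sub_cancel] at this
    rw [norm_smul, Real.norm_of_nonneg (by linarith [ht.1])] at h1
    nlinarith [ht.1]
  have hconv : ∀ t ∈ Ioc 1 (1 / β), ∫⁻ x, ‖bilinearIntegrand ϑ η t x‖ₑ ≤
      ENNReal.ofReal (2 * ‖η‖ * Real.exp (-‖η‖)) * radConv n F (‖η‖ * t) := by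
    intro t ht
    have h1 : ∀ᵐ x, ‖ϑ (t • η - x)‖ₑ ≤
        ENNReal.ofReal (Real.exp (-‖t • η - x‖)) * F ‖t • η - x‖ :=
      (quasiMeasurePreserving_sub_left volume (t • η)).ae hϑF
    have h2 : ‖η‖ * t = ‖t • η‖ := by
      rw [norm_smul, Real.norm_of_nonneg (by linarith [ht.1]), mul_comm]
    rw [h2, ← lintegral_norm_mul_norm_sub, ← lintegral_const_mul' _ _ ENNReal.ofReal_ne_top]
    refine lintegral_mono_ae ?_
    filter_upwards [hϑF, h1] with x hx hx'
    calc ‖bilinearIntegrand ϑ η t x‖ₑ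
        ≤ ENNReal.ofReal (2 * ‖η‖ * (‖ϑ x‖ * ‖ϑ (t • η - x)‖)) := by
          rw [← ofReal_norm]
          exact ENNReal.ofReal_le_ofReal (norm_bilinearIntegrand_le ϑ η t x)
      _ = ENNReal.ofReal (2 * ‖η‖) * (‖ϑ x‖ₑ * ‖ϑ (t • η - x)‖ₑ) := by
          rw [ENNReal.ofReal_mul (by positivity), ENNReal.ofReal_mul (norm_nonneg (ϑ x)), ofReal_norm,
            ofReal_norm]
      _ ≤ ENNReal.ofReal (2 * ‖η‖) * ((ENNReal.ofReal (Real.exp (-‖x‖)) * F ‖x‖) *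
            (ENNReal.ofReal (Real.exp (-‖t • η - x‖)) * F ‖t • η - x‖)) := by gcongr
      _ = ENNReal.ofReal (2 * ‖η‖) * ENNReal.ofReal (Real.exp (-‖x‖) * Real.exp (-‖t • η - x‖)) *
            (F ‖x‖ * F ‖t • η - x‖) := by
          rw [ENNReal.ofReal_mul (Real.exp_pos _).le]; ring
      _ ≤ ENNReal.ofReal (2 * ‖η‖) * ENNReal.ofReal (Real.exp (-‖η‖)) *
            (F ‖x‖ * F ‖t • η - x‖) := by
          gcongr
          exact hexp t ht x
      _ = _ := by rw [← ENNReal.ofReal_mul (by positivity)]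
  have htime : ∀ t ∈ Ioc 1 (1 / β), ‖timeFactor γ η t‖ₑ ≤
      ENNReal.ofReal B * ENNReal.ofReal (Real.exp (‖η‖ ^ γ * (1 - t ^ γ))) := by
    intro t ht
    have ht0 : 0 < t := by linarith [ht.1]
    rw [timeFactor, ← hc, Real.enorm_of_nonneg (by positivity), ← ENNReal.ofReal_mul hB0]
    apply ENNReal.ofReal_le_ofReal
    rw [div_eq_mul_inv, ← Real.rpow_neg ht0.le, mul_comm]
    gcongr
    exact rpow_le_add_of_mem_Icc one_pos ⟨ht.1.le, ht.2⟩ _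
  calc ∫⁻ t in Ioc 1 (1 / β), ∫⁻ x, ‖timeFactor γ η t • bilinearIntegrand ϑ η t x‖ₑ
      ≤ ∫⁻ t in Ioc 1 (1 / β), ENNReal.ofReal (B * (2 * ‖η‖ * Real.exp (-‖η‖))) *
          (ENNReal.ofReal (Real.exp (‖η‖ ^ γ * (1 - t ^ γ))) * radConv n F (‖η‖ * t)) := by
        refine setLIntegral_mono' measurableSet_Ioc fun t ht => ?_
        simp only [enorm_smul]
        rw [lintegral_const_mul' _ _ enorm_ne_top, ENNReal.ofReal_mul hB0]
        calc _ ≤ (ENNReal.ofReal B * ENNReal.ofReal (Real.exp (‖η‖ ^ γ * (1 - t ^ γ)))) *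
              (ENNReal.ofReal (2 * ‖η‖ * Real.exp (-‖η‖)) * radConv n F (‖η‖ * t)) :=
              mul_le_mul' (htime t ht) (hconv t ht)
          _ = _ := by ring
    _ ≤ ENNReal.ofReal (B * (2 * ‖η‖ * Real.exp (-‖η‖))) *
          ENNReal.ofReal (K * (min 1 (‖η‖ ^ (-γ)) ^ (1 - 1 / r) *
            ‖η‖ ^ (-(2 * m + 2 / p - (n + 1))))) := by
        rw [lintegral_const_mul' _ _ ENNReal.ofReal_ne_top]
        refine mul_le_mul' le_rfl ((lintegral_mono_set Ioc_subset_Icc_self).trans (hKρ ‖η‖ hη0))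
    _ = _ := by
        rw [← ENNReal.ofReal_mul (by positivity)]
        congr 1
        ring

theorem renormConvergesAt_of_lintegral_lt_top {d : ℕ}
    {ϑ : EuclideanSpace ℝ (Fin d) → EuclideanSpace ℂ (Fin d)}
    (hϑ : AEStronglyMeasurable ϑ volume) {γ β : ℝ} {η : EuclideanSpace ℝ (Fin d)}
    (h : ∫⁻ t in Ioc 1 (1 / β), ∫⁻ x, ‖timeFactor γ η t • bilinearIntegrand ϑ η t x‖ₑ < ⊤) :
    RenormConvergesAt γ β ϑ η := by
  have hm := aestronglyMeasurable_bilinear hϑ γ η (volume.restrict (Ioc 1 (1 / β)))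
  refine ⟨hm, ?_⟩
  rw [HasFiniteIntegral, lintegral_prod _ hm.enorm]
  exact h

/-- In the linear term 1 - β^{-γ} ≤ 0, so its exponential is at most 1. The nonlinear term is
bounded by the integral of norms. -/
theorem norm_renorm_le {d : ℕ} {ϑ : EuclideanSpace ℝ (Fin d) → EuclideanSpace ℂ (Fin d)}
    {γ β V : ℝ} (hγ : 0 < γ) (hβ : 0 < β) (hβ1 : β < 1) (hV : 0 ≤ V)
    {η : EuclideanSpace ℝ (Fin d)}
    (h : ∫⁻ t in Ioc 1 (1 / β), ∫⁻ x, ‖timeFactor γ η t • bilinearIntegrand ϑ η t x‖ₑ ≤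
      ENNReal.ofReal V) :
    ‖renorm γ β ϑ η‖ ≤ β ^ cExp d γ * ‖ϑ ((1 / β) • η)‖ + γ * V := by
  have h5 : (1 : ℝ) ≤ 1 / β := by rw [le_div_iff₀ hβ]; linarith
  rw [renorm, intervalIntegral.integral_of_le h5]
  refine (norm_add_le _ _).trans (add_le_add ?_ ?_)
  · rw [norm_smul, Real.norm_of_nonneg (by positivity)]
    gcongr
    refine mul_le_of_le_one_right (by positivity) ?_
    rw [Real.exp_le_one_iff]
    refine mul_nonpos_of_nonneg_of_nonpos (by positivity) ?_
    have : β ^ γ ≤ 1 := Real.rpow_le_one hβ.le hβ1.le hγ.le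
    have : 1 ≤ 1 / β ^ γ := by rw [le_div_iff₀ (by positivity)]; linarith
    linarith
  · rw [norm_smul, norm_mul, Complex.norm_I, one_mul, Complex.norm_real, Real.norm_of_nonneg hγ.le]
    gcongr
    have h6 : ‖∫ t in Ioc 1 (1 / β), timeFactor γ η t • ∫ x, bilinearIntegrand ϑ η t x‖ₑ ≤
        ENNReal.ofReal V := by
      refine (enorm_integral_le_lintegral_enorm _).trans (le_trans ?_ h)
      refine lintegral_mono fun t => ?_
      rw [← integral_smul]
      exact enorm_integral_le_lintegral_enorm _
    rw [← ofReal_norm] at h6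
    exact (ENNReal.ofReal_le_ofReal_iff hV).1 h6

end NSRenorm

/-! ### Admissible exponents, the dominating field and the conclusion. -/

namespace NSRenorm

theorem memLp_comp_const_smul {E G : Type*} [NormedAddCommGroup E] [NormedSpace ℝ E]
    [MeasurableSpace E] [BorelSpace E] [FiniteDimensional ℝ E] {μ : Measure E}
    [μ.IsAddHaarMeasure] [NormedAddCommGroup G] {f : E → G} {p : ℝ≥0∞} (hf : MemLp f p μ) {R : ℝ}
    (hR : R ≠ 0) : MemLp (fun x => f (R • x)) p μ := by
  have h : MemLp f p (μ.map (R • ·)) := by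
    rw [Measure.map_addHaar_smul μ hR]
    exact hf.smul_measure ENNReal.ofReal_ne_top
  exact h.comp_of_map (measurable_const_smul R).aemeasurable

/-- The numerical consequences of the hypotheses: `r` can be replaced by an exponent `r₁ ≥ p` for
which the condition on `ν + κ` is strict. -/
theorem exists_admissible_exponent {n : ℕ} (hn : 1 ≤ n) {γ p r ν κ : ℝ} (hp : 1 < p) (hr : 1 < r)
    (hscale : 1 / r = 2 / p + (2 * ν + κ) / ((n : ℝ) + 1) - 1)
    (hν₁ : (n : ℝ) / 2 * (1 - 2 / p) < ν) (hν₂ : ν < ((n : ℝ) + 1) * ((p - 1) / p))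
    (hνκ : (n : ℝ) * (1 / r - 1 / p) ≤ ν + κ)
    (hlow : 0 < ((n : ℝ) + 1) * (r - p) / r + p * (ν + κ + 1))
    (hupp : ((n : ℝ) + 1) * (r - p) / r + p * (ν + κ + 1) < γ * p * (r - 1) / r) :
    0 < γ ∧ ∃ r₁ : ℝ, p ≤ r₁ ∧ singExp n < 2 + 1 / r₁ - 2 / p ∧
      0 < n - 1 - (ν + n / p) + (2 + 1 / r₁ - 2 / p) ∧
      ((n : ℝ) + 1) * (r - p) / r + p * (ν + κ + 1) < γ * p * (1 - 1 / r₁) := by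
  have hp0 : 0 < p := by linarith
  have hr0 : 0 < r := by linarith
  set E := ((n : ℝ) + 1) * (r - p) / r + p * (ν + κ + 1) with hE
  have hγ' : γ * p * (r - 1) / r = γ * (p * ((r - 1) / r)) := by ring
  have hγ : 0 < γ := by
    have h1 : 0 < γ * (p * ((r - 1) / r)) := by rw [← hγ']; exact hlow.trans hupp
    have h2 : 0 < (r - 1) / r := div_pos (by linarith) hr0
    exact pos_of_mul_pos_left h1 (by positivity)
  refine ⟨hγ, ?_⟩
  have hγp : 0 < γ * p := by positivity
  have hupp' : E < γ * p * (1 - 1 / r) := by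
    have : γ * p * (r - 1) / r = γ * p * (1 - 1 / r) := by field_simp
    rwa [← this]
  set P := 1 / p with hP
  set X := 1 / r with hX
  have h2p : 2 / p = 2 * P := by rw [hP]; ring
  have hnp : (n : ℝ) / p = n * P := by rw [hP]; ring
  have hpp : (p - 1) / p = 1 - P := by rw [hP]; field_simp
  have hPlt : P < 1 := by rw [hP, div_lt_one hp0]; exact hp
  have hP0 : 0 < P := by positivity
  have hκ : κ = (n + 1) * (X + 1 - 2 * P) - 2 * ν := by
    have hn1 : (n : ℝ) + 1 ≠ 0 := by positivity
    rw [h2p] at hscale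
    have : (2 * ν + κ) / ((n : ℝ) + 1) = X + 1 - 2 * P := by linarith
    rw [div_eq_iff hn1] at this
    linarith
  rw [h2p] at hν₁
  rw [hpp] at hν₂
  -- Here x is the reciprocal of the new exponent. If r ≤ p, take x = 1/p: the third condition
  -- becomes the upper bound on ν. If r > p, the condition on ν + κ is the non-strict third
  -- condition at x = 1/r; a slightly larger x makes it strict, and the strict upper bound on E
  -- leaves room for that.
  obtain ⟨x, hx0, hxP, hx1, hxE⟩ : ∃ x, 0 < x ∧ x ≤ P ∧
      0 < n - 1 - (ν + n * P) + (2 + x - 2 * P) ∧ E < γ * p * (1 - x) := by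
    rcases le_or_gt r p with h | h
    · refine ⟨P, hP0, le_rfl, by nlinarith, ?_⟩
      have h1 : P ≤ X := one_div_le_one_div_of_le hr0 h
      refine hupp'.trans_le (mul_le_mul_of_nonneg_left ?_ hγp.le)
      linarith
    · have h1 : X < P := one_div_lt_one_div_of_lt hp0 h
      have h2 : X < 1 - E / (γ * p) := by
        rw [lt_sub_comm, div_lt_iff₀ hγp]
        linarith
      obtain ⟨x, hxX, hxm⟩ := exists_between (lt_min h1 h2)
      have h3 := hxm.trans_le (min_le_left _ _)
      have h4 := hxm.trans_le (min_le_right _ _)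
      refine ⟨x, (by positivity : 0 < X).trans hxX, h3.le, ?_, ?_⟩
      · rw [hκ] at hνκ
        nlinarith
      · rw [lt_sub_comm, div_lt_iff₀ hγp] at h4
        linarith
  refine ⟨1 / x, ?_, ?_, ?_, ?_⟩
  · rw [le_div_iff₀ hx0]
    calc p * x ≤ p * P := by gcongr
      _ = 1 := by rw [hP]; field_simp
  · rw [one_div_one_div, h2p]
    unfold singExp
    split_ifs with h
    -- In dimension two, the lower bound on ν and the third condition add up to 1/2 < 2 + x - 2/p.
    · rw [h] at hν₁ hx1
      push_cast at hν₁ hx1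
      linarith
    · linarith
  · rw [one_div_one_div, h2p, hnp]; exact hx1
  · rw [one_div_one_div]; exact hxE

theorem uWeight_le_dilate {d : ℕ} {β : ℝ} (hβ : 0 < β) (hβ1 : β < 1) (ν : ℝ)
    (η : EuclideanSpace ℝ (Fin d)) : uWeight ν η ≤ β ^ ν * uWeight ν ((1 / β) • η) := by
  unfold uWeight
  have h1 : (1 : ℝ) ≤ 1 / β := by rw [le_div_iff₀ hβ]; linarith
  rw [norm_smul, Real.norm_of_nonneg (by positivity), Real.mul_rpow (by positivity)
    (norm_nonneg _), one_div, Real.inv_rpow hβ.le]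
  have h2 : Real.exp ‖η‖ ≤ Real.exp (β⁻¹ * ‖η‖) := by
    rw [Real.exp_le_exp]
    rw [one_div] at h1
    nlinarith [norm_nonneg η]
  have h3 : β ^ ν ≠ 0 := (Real.rpow_pos_of_pos hβ ν).ne'
  calc _ ≤ Real.exp (β⁻¹ * ‖η‖) * ‖η‖ ^ ν := by gcongr
    _ = _ := by field_simp

theorem uWeight_nonneg {d : ℕ} (ν : ℝ) (x : EuclideanSpace ℝ (Fin d)) : 0 ≤ uWeight ν x := by
  unfold uWeight; positivity

theorem measurable_uWeight {d : ℕ} (ν : ℝ) : Measurable (uWeight (d := d) ν) := by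
  unfold uWeight; fun_prop

theorem MemWeightedLp.of_norm_le {d : ℕ} {ν p : ℝ}
    {f g : EuclideanSpace ℝ (Fin d) → EuclideanSpace ℂ (Fin d)} (hg : MemWeightedLp (uWeight ν) p g)
    (hf : AEStronglyMeasurable f volume) (h : ∀ᵐ x, ‖f x‖ ≤ ‖g x‖) :
    MemWeightedLp (uWeight ν) p f := by
  refine ⟨hf, hg.2.mono ((measurable_uWeight ν).aestronglyMeasurable.smul hf) ?_⟩
  filter_upwards [h] with x hx
  rw [norm_smul, norm_smul]
  gcongr

/-- The radial field dominating `renorm γ β ϑ`. -/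
noncomputable def dominatingField {n : ℕ} (c γ β K x y : ℝ)
    (g : EuclideanSpace ℝ (Fin (n + 1)) → EuclideanSpace ℂ (Fin (n + 1)))
    (η : EuclideanSpace ℝ (Fin (n + 1))) : EuclideanSpace ℂ (Fin (n + 1)) :=
  EuclideanSpace.single 0 ((β ^ c * ‖g ((1 / β) • η)‖ + γ * (K * (‖η‖ * Real.exp (-‖η‖) *
    (min 1 (‖η‖ ^ (-γ)) ^ y * ‖η‖ ^ x))) : ℝ) : ℂ)

theorem isRadialField_dominatingField {n : ℕ} (c γ β K x y : ℝ)
    {g : EuclideanSpace ℝ (Fin (n + 1)) → EuclideanSpace ℂ (Fin (n + 1))} (hg : IsRadialField g) :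
    IsRadialField (dominatingField c γ β K x y g) := by
  intro η η' h
  have h1 : g ((1 / β) • η) = g ((1 / β) • η') := hg _ _ (by rw [norm_smul, norm_smul, h])
  rw [dominatingField, dominatingField, h1, h]

theorem norm_dominatingField {n : ℕ} {c γ β K x y : ℝ} (hγ : 0 ≤ γ) (hβ : 0 ≤ β) (hK : 0 ≤ K)
    (g : EuclideanSpace ℝ (Fin (n + 1)) → EuclideanSpace ℂ (Fin (n + 1)))
    (η : EuclideanSpace ℝ (Fin (n + 1))) :
    ‖dominatingField c γ β K x y g η‖ = β ^ c * ‖g ((1 / β) • η)‖ + γ * (K * (‖η‖ *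
      Real.exp (-‖η‖) * (min 1 (‖η‖ ^ (-γ)) ^ y * ‖η‖ ^ x))) := by
  have hmin : 0 ≤ min 1 (‖η‖ ^ (-γ)) := le_min zero_le_one (by positivity)
  rw [dominatingField, PiLp.norm_single, Complex.norm_real,
    Real.norm_of_nonneg (by positivity)]

/-- The first summand is controlled by a dilate of the weighted field g. In the second, e^{|η|} from
the weight cancels e^{-|η|} and leaves a radial power with exponent ν + 1 + x. -/
theorem memWeightedLp_dominatingField {n : ℕ} {c γ β K x y ν p : ℝ} (hp : 1 ≤ p) (hγ : 0 ≤ γ)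
    (hβ : 0 < β) (hβ1 : β < 1) (hK : 0 ≤ K) (hy : 0 ≤ y) (h0 : 0 < n + 1 + p * (ν + 1 + x))
    (h1 : n + 1 + p * (ν + 1 + x) < γ * p * y)
    {g : EuclideanSpace ℝ (Fin (n + 1)) → EuclideanSpace ℂ (Fin (n + 1))}
    (hg : MemWeightedLp (uWeight ν) p g) :
    MemWeightedLp (uWeight ν) p (dominatingField c γ β K x y g) := by
  have hp0 : 0 < p := by linarith
  have hβ' : (1 / β : ℝ) ≠ 0 := by positivity
  have hgβ : AEStronglyMeasurable (fun η => g ((1 / β) • η)) volume :=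
    hg.1.comp_quasiMeasurePreserving (Measure.quasiMeasurePreserving_smul volume hβ')
  have hm : AEStronglyMeasurable (dominatingField c γ β K x y g) volume := by
    have hs : Continuous fun a : ℝ =>
        (EuclideanSpace.single 0 (a : ℂ) : EuclideanSpace ℂ (Fin (n + 1))) := by
      have : (fun a : ℝ => (EuclideanSpace.single 0 (a : ℂ) : EuclideanSpace ℂ (Fin (n + 1)))) =
          fun a : ℝ => (a : ℂ) • EuclideanSpace.single 0 (1 : ℂ) := by
        funext a; ext i; simp
      rw [this]; fun_prop
    have h2 : Measurable fun η : EuclideanSpace ℝ (Fin (n + 1)) =>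
      γ * (K * (‖η‖ * Real.exp (-‖η‖) * (min 1 (‖η‖ ^ (-γ)) ^ y * ‖η‖ ^ x))) := by fun_prop
    exact hs.comp_aestronglyMeasurable
      ((hgβ.norm.const_mul (β ^ c)).add h2.aestronglyMeasurable)
  refine ⟨hm, ?_⟩
  have hA : MemLp (fun η => ‖uWeight ν ((1 / β) • η) • g ((1 / β) • η)‖) (ENNReal.ofReal p) :=
    (memLp_comp_const_smul hg.2 hβ').norm
  have hB := memLp_radial_power (n := n) (γ := γ) hp0 hy h0 h1
  have hS := (hA.const_mul (β ^ ν * β ^ c)).add (hB.const_mul (γ * K))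
  refine hS.mono ((measurable_uWeight ν).aestronglyMeasurable.smul hm) ?_
  filter_upwards [Measure.ae_ne volume (0 : EuclideanSpace ℝ (Fin (n + 1)))] with η hη
  have hη0 : 0 < ‖η‖ := norm_pos_iff.2 hη
  have hmin : 0 ≤ min 1 (‖η‖ ^ (-γ)) := le_min zero_le_one (by positivity)
  rw [norm_smul, norm_dominatingField hγ hβ.le hK, Real.norm_of_nonneg (uWeight_nonneg ν η), mul_add,
    Pi.add_apply]
  refine le_trans (add_le_add ?_ (le_of_eq ?_)) (Real.le_norm_self _)
  · rw [norm_smul, Real.norm_of_nonneg (uWeight_nonneg ν _)]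
    calc uWeight ν η * (β ^ c * ‖g ((1 / β) • η)‖)
        ≤ (β ^ ν * uWeight ν ((1 / β) • η)) * (β ^ c * ‖g ((1 / β) • η)‖) := by
          gcongr
          exact uWeight_le_dilate hβ hβ1 ν η
      _ = _ := by ring
  · have e1 : ‖η‖ ^ (ν + 1 + x) = ‖η‖ ^ ν * ‖η‖ * ‖η‖ ^ x := by
      rw [Real.rpow_add hη0, Real.rpow_add hη0, Real.rpow_one]
    have e2 : Real.exp ‖η‖ * Real.exp (-‖η‖) = 1 := by rw [← Real.exp_add]; simp
    rw [uWeight, e1]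
    linear_combination (‖η‖ ^ ν * γ * K * ‖η‖ * min 1 (‖η‖ ^ (-γ)) ^ y * ‖η‖ ^ x) * e2

end NSRenorm

theorem mainTheorem7 (d : ℕ) (hd : 2 ≤ d) (γ p r ν κ : ℝ)
    (hp : 1 < p) (hr : 1 < r)
    (hscale : 1 / r = 2 / p + (2 * ν + κ) / (d : ℝ) - 1)
    (hκ : κ < (d : ℝ) / r)
    (hν₁ : ((d : ℝ) - 1) / 2 * (1 - 2 / p) < ν)
    (hν₂ : ν < (d : ℝ) * ((p - 1) / p))
    (hrp : p ≤ 2 * r)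
    (hmax : 0 < max ν κ)
    (hνκ : ((d : ℝ) - 1) * (1 / r - 1 / p) ≤ ν + κ)
    (hlow : max 0 ((d : ℝ) + p * (NSRenorm.cExp d γ + ν)) <
      (d : ℝ) * (r - p) / r + p * (ν + κ + 1))
    (hupp : (d : ℝ) * (r - p) / r + p * (ν + κ + 1) < γ * p * (r - 1) / r) :
    ∀ β : ℝ, 0 < β → β < 1 →
      ∀ ϑ ∈ NSRenorm.radiallyDominated (d := d) (NSRenorm.uWeight ν) p,
        (∀ᵐ η ∂(MeasureTheory.volume : MeasureTheory.Measure (EuclideanSpace ℝ (Fin d))),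
          NSRenorm.RenormConvergesAt γ β ϑ η) ∧
        NSRenorm.renorm γ β ϑ ∈
          NSRenorm.radiallyDominated (d := d) (NSRenorm.uWeight ν) p := by
  intro β hβ hβ1 ϑ hϑ
  obtain ⟨n, rfl⟩ : ∃ n, d = n + 1 := ⟨d - 1, by omega⟩
  have hn : 1 ≤ n := by omega
  have hp0 : 0 < p := by linarith
  have hr0 : 0 < r := by linarith
  push_cast at hscale hν₁ hν₂ hνκ hlow hupp hκ
  rw [add_sub_cancel_right] at hν₁ hνκ
  have hlow' := (le_max_left _ _).trans_lt hlow
  obtain ⟨hγ, r₁, hpr, hl, he, hup⟩ :=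
    NSRenorm.exists_admissible_exponent hn hp hr hscale hν₁ hν₂ hνκ hlow' hupp
  obtain ⟨hϑm, g, hg, hgrad, hdom⟩ := hϑ
  obtain ⟨F, hF, hFg, hFp⟩ := NSRenorm.exists_profile_of_memWeightedLp hp0 hg hgrad
  have hn1 : (0 : ℝ) < (n : ℝ) + 1 := by positivity
  -- The scaling relation identifies the decay of the convolution as d/r - κ. The right side is free
  -- of r, so passing to r₁ does not alter it.
  have hκA : ((n : ℝ) + 1) / r - κ = 2 * (ν + n / p) + 2 / p - (n + 1) := by
    have h1 : ((n : ℝ) + 1) * (1 / r) = ((n : ℝ) + 1) * (2 / p - 1) + (2 * ν + κ) := by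
      rw [hscale]; field_simp; ring
    linear_combination h1
  have hE : ((n : ℝ) + 1) * (r - p) / r + p * (ν + κ + 1) =
      n + 1 + p * (ν + 1 + -(2 * (ν + n / p) + 2 / p - (n + 1))) := by
    rw [← hκA]; field_simp; ring
  rw [hE] at hlow' hup
  have hϑF : ∀ᵐ x, ‖ϑ x‖ₑ ≤ ENNReal.ofReal (Real.exp (-‖x‖)) * F ‖x‖ := by
    filter_upwards [hdom, hFg] with x h1 h2
    rw [← h2]
    exact enorm_le_iff_norm_le.2 h1
  have hσ0 : (n : ℝ) ≤ 2 * (ν + n / p) := by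
    have : (n : ℝ) / 2 * (1 - 2 / p) = n / 2 - n / p := by ring
    linarith
  -- This is κ < d/r, rewritten through `hκA`.
  have hσ : 1 - 2 / p < 2 * (ν + n / p) - n := by linarith
  obtain ⟨K, hK, hKη⟩ := NSRenorm.exists_lintegral_bilinear_le hn hp hpr hl he hσ0 hσ hγ hβ hF hFp
    hϑF
  have hne : ∀ᵐ η : EuclideanSpace ℝ (Fin (n + 1)), η ≠ 0 := Measure.ae_ne volume 0
  refine ⟨?_, ?_⟩
  · filter_upwards [hne] with η hη
    exact NSRenorm.renormConvergesAt_of_lintegral_lt_top hϑm.1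
      ((hKη η hη).trans_lt ENNReal.ofReal_lt_top)
  · have hr₁ : 0 ≤ 1 - 1 / r₁ := by
      rw [sub_nonneg, div_le_one (by linarith)]; linarith
    set G := NSRenorm.dominatingField (NSRenorm.cExp (n + 1) γ) γ β K
      (-(2 * (ν + n / p) + 2 / p - (n + 1))) (1 - 1 / r₁) g with hG
    have hGm : NSRenorm.MemWeightedLp (NSRenorm.uWeight ν) p G :=
      NSRenorm.memWeightedLp_dominatingField hp.le hγ.le hβ hβ1 hK hr₁ hlow' hup hg
    have hle : ∀ᵐ η, ‖NSRenorm.renorm γ β ϑ η‖ ≤ ‖G η‖ := by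
      have h1 : ∀ᵐ η : EuclideanSpace ℝ (Fin (n + 1)),
          ‖ϑ ((1 / β) • η)‖ ≤ ‖g ((1 / β) • η)‖ :=
        (Measure.quasiMeasurePreserving_smul volume (by positivity : (1 / β : ℝ) ≠ 0)).ae hdom
      filter_upwards [hne, h1] with η hη h2
      have hmin : 0 ≤ min 1 (‖η‖ ^ (-γ)) := le_min zero_le_one (by positivity)
      rw [hG, NSRenorm.norm_dominatingField hγ.le hβ.le hK]
      refine (NSRenorm.norm_renorm_le hγ hβ hβ1 (by positivity) (hKη η hη)).trans ?_
      gcongr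
    exact ⟨hGm.of_norm_le (NSRenorm.aestronglyMeasurable_renorm hϑm.1 γ hβ hβ1) hle, G, hGm,
      NSRenorm.isRadialField_dominatingField _ _ _ _ _ _ hgrad, hle⟩
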